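/- Let $d\ge 1$ be an integer. A partition of $k\ge 0$ into at most $d$ parts is $\iota=(k_1,\dots,k_d)\in\mathbb{Z}^d$ with $k_1\ge\dots\ge k_d\ge 0$ and $|\iota|:=k_1+\dots+k_d=k$; put $$(a)_\iota=\prod_{j=1}^d\Big(a-\tfrac{j-1}{2}\Big)_{k_j},\qquad (a)_n=a(a+1)\cdots(a+n-1),\quad (a)_0=1 .$$ The zonal polynomials $C_\iota(\alpha_1,\dots,\alpha_d)$, $|\iota|=k$, are the symmetric polynomials with complex coefficients, homogeneous of degree $k$, such that 1. the coefficient of $\alpha_1^{k_1}\cdots\alpha_d^{k_d}$ in $C_\iota$ is non-zero, and every monomial $\alpha_1^{s_1}\cdots\alpha_d^{s_d}$ occurring in $C_\iota$ satisfies $s_1+\dots+s_j\le k_1+\dots+k_j$ for $j=1,\dots,d$ (so that, in particular, $\alpha_1^{k_1}\cdots\alpha_d^{k_d}$ is its lexicographically highest monomial); 2. $C_\iota$ is an eigenfunction of $$\Delta=\sum_{j=1}^d\alpha_j^2\frac{\partial^2}{\partial\alpha_j^2}+\sum_{j=1}^d\sum_{i\ne j}\frac{\alpha_j^2}{\alpha_j-\alpha_i}\frac{\partial}{\partial\alpha_j};$$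 3. $\sum_{|\iota|=k}C_\iota(\alpha_1,\dots,\alpha_d)=(\alpha_1+\dots+\alpha_d)^k$. Define $${}_0F_1(b;\alpha_1,\dots,\alpha_d)=\sum_{k=0}^\infty\sum_{|\iota|=k}\frac{1}{(b)_\iota}\frac{C_\iota(\alpha_1,\dots,\alpha_d)}{k!},\qquad {}_0^mF_1(b;\alpha_1,\dots,\alpha_d)=\sum_{k=0}^m\sum_{|\iota|=k}\frac{1}{(b)_\iota}\frac{C_\iota(\alpha_1,\dots,\alpha_d)}{k!}.$$ **Proposition.** For every $k\ge0$ there is exactly one family $(C_\iota)_{|\iota|=k}$ with the properties 1–3. Let $b>\frac12(d-1)$ be real, let $m\ge d-1$ be an integer, and let $\alpha_1,\dots,\alpha_d\in\mathbb{C}$. Then the series ${}_0F_1(b;\alpha_1,\dots,\alpha_d)$ converges, $(b)_{\hat\iota(m+1)}>0$, and $$\big|{}_0F_1(b;\alpha_1,\dots,\alpha_d)-{}_0^mF_1(b;\alpha_1,\dots,\alpha_d)\big|\le\frac{(|\alpha_1|+\dots+|\alpha_d|)^{m+1}}{(m+1)!\,(b)_{\hat\iota(m+1)}}\,e^{|\alpha_1|+\dots+|\alpha_d|},$$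 where $\hat\iota(m+1)$ is the lexicographically smallest partition of $m+1$ into at most $d$ parts. -/

import Mathlib

/-- Partitions `ι = (k₁ ≥ k₂ ≥ ⋯ ≥ k_d ≥ 0)` of `k` into not more than `d` parts. -/
def parts (d k : ℕ) : Finset (Fin d → ℕ) :=
  open Classical in (Finset.Nat.antidiagonalTuple d k).filter (fun ι => Antitone ι)

theorem mem_parts {d k : ℕ} {ι : Fin d → ℕ} :
    ι ∈ parts d k ↔ (∑ i, ι i = k ∧ Antitone ι) := by
  simp [parts, Finset.Nat.mem_antidiagonalTuple]

theorem parts_nonempty (d k : ℕ) [NeZero d] : (parts d k).Nonempty := by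
  refine ⟨Pi.single 0 k, mem_parts.2 ⟨by simp, ?_⟩⟩
  intro i j hij
  by_cases hj : j = 0
  · subst hj
    have : i = 0 := le_antisymm hij (Fin.zero_le i)
    simp [this]
  · simp [Pi.single_apply, hj]

/-- The lexicographically smallest partition of `k` into not more than `d` parts. -/
noncomputable def lexMinPart (d k : ℕ) [NeZero d] : Fin d → ℕ :=
  ofLex (((parts d k).image toLex).min' ((parts_nonempty d k).image toLex))

/-- The generalized hypergeometric coefficient
`(a)_ι = ∏_{j = 1}^d (a - (j - 1) / 2)_{k_j}` (here `j` is counted from `0`). -/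
noncomputable def genPochhammer {K : Type*} [Field K] {d : ℕ} (a : K) (ι : Fin d → ℕ) : K :=
  ∏ j : Fin d, (ascPochhammer K (ι j)).eval (a - (j : ℕ) / 2)

/-- The value at `α` of `Δ p`, where
`Δ = ∑_j α_j² ∂²/∂α_j² + ∑_j ∑_{i ≠ j} α_j² / (α_j - α_i) ∂/∂α_j`.
It is meant for points `α` with pairwise distinct coordinates. -/
noncomputable def deltaAt {d : ℕ} (p : MvPolynomial (Fin d) ℂ) (α : Fin d → ℂ) : ℂ :=
  ∑ j, α j ^ 2 * MvPolynomial.eval α (MvPolynomial.pderiv j (MvPolynomial.pderiv j p)) +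
    ∑ j, ∑ i ∈ Finset.univ.erase j,
      α j ^ 2 / (α j - α i) * MvPolynomial.eval α (MvPolynomial.pderiv j p)

/-- `Z` is the family of zonal polynomials, in `d` variables, of the partitions of `k`.
The condition `dominated` compares the exponents with `ι` in the dominance order; in particular
every monomial of `Z ι` other than `α^ι` comes after `α^ι` in the lexicographic order. -/
structure IsZonalFamily (d k : ℕ) (Z : parts d k → MvPolynomial (Fin d) ℂ) : Prop where
  symmetric : ∀ ι, (Z ι).IsSymmetric
  homogeneous : ∀ ι, (Z ι).IsHomogeneous k
  leading : ∀ ι : parts d k,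
    MvPolynomial.coeff (Finsupp.equivFunOnFinite.symm (ι : Fin d → ℕ)) (Z ι) ≠ 0
  dominated : ∀ ι : parts d k, ∀ s ∈ (Z ι).support, ∀ j : Fin d,
    ∑ i ∈ Finset.Iic j, s i ≤ ∑ i ∈ Finset.Iic j, (ι : Fin d → ℕ) i
  eigen : ∀ ι, ∃ c : ℂ, ∀ α : Fin d → ℂ, Function.Injective α →
    deltaAt (Z ι) α = c * MvPolynomial.eval α (Z ι)
  sum_eq : ∑ ι, Z ι = (∑ i, MvPolynomial.X i) ^ k

/-- The zonal polynomials `C_ι`, for `ι` a partition of `k` into not more than `d` parts: the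
family described by `IsZonalFamily`. -/
noncomputable def zonal (d k : ℕ) : parts d k → MvPolynomial (Fin d) ℂ :=
  Classical.epsilon (IsZonalFamily d k)

/-- The part of degree `k` of the series of `₀F₁(b; α₁, …, α_d)`:
`∑_{|ι| = k} C_ι(α₁, …, α_d) / ((b)_ι k!)`. -/
noncomputable def hyp0F1Term {d : ℕ} (b : ℂ) (α : Fin d → ℂ) (k : ℕ) : ℂ :=
  ∑ ι : parts d k, 1 / genPochhammer b (ι : Fin d → ℕ) *
    (MvPolynomial.eval α (zonal d k ι) / (k.factorial : ℂ))

/-- The hypergeometric function `₀F₁(b; α₁, …, α_d)`. -/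
noncomputable def hyp0F1 {d : ℕ} (b : ℂ) (α : Fin d → ℂ) : ℂ :=
  ∑' k : ℕ, hyp0F1Term b α k

/-- The series of `₀F₁(b; α₁, …, α_d)` truncated after degree `m`. -/
noncomputable def hyp0F1Trunc {d : ℕ} (m : ℕ) (b : ℂ) (α : Fin d → ℂ) : ℂ :=
  ∑ k ∈ Finset.range (m + 1), hyp0F1Term b α k

/-! The zonal polynomials are the symmetric Jack polynomials with parameter 2, and the estimate
rests on one fact about them: their coefficients are nonnegative. Hence `|C_ι(α)| ≤ C_ι(|α_1|, …,
|α_d|)`, and by property 3 these bounds add up to `(∑ |α_i|) ^ k`. It remains to bound `(b)_ι` below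
by its value at the balanced partition of `m + 1` whenever `|ι| ≥ m + 1 ≥ d`
(`genPochhammer_balancedPart_le`), and `(k + m + 1)! ≥ k! (m + 1)!` turns the tail into an
exponential series.

Nonnegativity comes from a recursion of Knop–Sahi type. The nonsymmetric Jack polynomials `E_η` are
joint eigenvectors of the Cherednik operators. All of them arise from `1` by the raising operator
and by the intertwiners `s_k + c` with `0 < c < 1`, which preserve nonnegative coefficients
(`exists_isNonsymJack`). Their joint eigenvalues separate compositions, so they form a basis.
Summing `E_ι` over all permutations of the variables gives `symJack ι`.

To satisfy property 3 by positive multiples of the `symJack ι`, the power `(∑ x_i) ^ k` must have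
positive coordinates (`jackCoord_sum_X_pow_pos`). The induction on `k` works because, after
symmetrization, multiplying a symmetric polynomial by `∑ x_i` amounts to applying the raising
operator.

For property 2, with `d = n + 1`, the sum of the squares of the Heckman operators acts on symmetric
polynomials as `4 Δ + (4 - 2 n) ∑ x_i ∂_i` (`deltaAt_map`). Its eigenvalue on `symJack ι` increases
strictly in the dominance order (`squareEigenvalue_lt`). So properties 1 and 2 determine `C_ι` up to
a scalar, and property 3 fixes the scalars by linear independence. -/

open MvPolynomial

/-! ### Divided differences and Heckman operators -/

theorem X_sub_X_dvd_sub_rename_swap {σ R : Type*} [DecidableEq σ] [CommRing R] (i j : σ)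
    (f : MvPolynomial σ R) : (X i - X j) ∣ f - rename (Equiv.swap i j) f := by
  rw [← Ideal.mem_span_singleton, ← Ideal.Quotient.eq]
  set I : Ideal (MvPolynomial σ R) := Ideal.span {X i - X j}
  have hX : Ideal.Quotient.mk I (X i) = Ideal.Quotient.mk I (X j) :=
    Ideal.Quotient.eq.2 (Ideal.subset_span rfl)
  -- Modulo `X i - X j` the two variables coincide, so the transposition becomes the identity.
  have h : Ideal.Quotient.mkₐ R I = (Ideal.Quotient.mkₐ R I).comp (rename (Equiv.swap i j)) := by
    ext k
    by_cases hi : k = i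
    · subst hi; simpa using hX
    by_cases hj : k = j
    · subst hj; simpa using hX.symm
    simp [Equiv.swap_apply_of_ne_of_ne hi hj]
  exact DFunLike.congr_fun h f

theorem rename_swap_rename_perm {σ R : Type*} [DecidableEq σ] [CommSemiring R]
    (w : Equiv.Perm σ) (i j : σ) (f : MvPolynomial σ R) :
    rename w (rename (Equiv.swap i j) f) = rename (Equiv.swap (w i) (w j)) (rename w f) := by
  rw [rename_rename, rename_rename]
  congr 2
  ext k
  simp [Equiv.swap_apply_def]
  split_ifs <;> rfl

/-- The divided difference `(f - s_{ij} f) / (x_i - x_j)`. -/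
noncomputable def divDiff {d : ℕ} (i j : Fin d) (f : MvPolynomial (Fin d) ℝ) :
    MvPolynomial (Fin d) ℝ :=
  Classical.choose (X_sub_X_dvd_sub_rename_swap i j f)

section operators

variable {d : ℕ}

theorem divDiff_spec (i j : Fin d) (f : MvPolynomial (Fin d) ℝ) :
    (X i - X j) * divDiff i j f = f - rename (Equiv.swap i j) f :=
  (Classical.choose_spec (X_sub_X_dvd_sub_rename_swap i j f)).symm

theorem X_sub_X_ne_zero {i j : Fin d} (hij : i ≠ j) :
    (X i - X j : MvPolynomial (Fin d) ℝ) ≠ 0 :=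
  sub_ne_zero.2 fun h => hij (X_injective h)

theorem divDiff_eq {i j : Fin d} (hij : i ≠ j) {f g : MvPolynomial (Fin d) ℝ}
    (h : (X i - X j) * g = f - rename (Equiv.swap i j) f) : divDiff i j f = g :=
  mul_left_cancel₀ (X_sub_X_ne_zero hij) ((divDiff_spec i j f).trans h.symm)

theorem divDiff_add {i j : Fin d} (hij : i ≠ j) (f g : MvPolynomial (Fin d) ℝ) :
    divDiff i j (f + g) = divDiff i j f + divDiff i j g :=
  divDiff_eq hij (by rw [mul_add, divDiff_spec, divDiff_spec, map_add]; ring)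

theorem divDiff_smul {i j : Fin d} (hij : i ≠ j) (c : ℝ) (f : MvPolynomial (Fin d) ℝ) :
    divDiff i j (c • f) = c • divDiff i j f :=
  divDiff_eq hij (by rw [mul_smul_comm, divDiff_spec, map_smul, smul_sub])

theorem rename_divDiff {i j : Fin d} (hij : i ≠ j) (w : Equiv.Perm (Fin d))
    (f : MvPolynomial (Fin d) ℝ) :
    rename w (divDiff i j f) = divDiff (w i) (w j) (rename w f) := by
  symm
  apply divDiff_eq (w.injective.ne hij)
  rw [← rename_swap_rename_perm, ← map_sub, ← divDiff_spec i j f]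
  simp

theorem divDiff_eq_zero {i j : Fin d} (hij : i ≠ j) {f : MvPolynomial (Fin d) ℝ}
    (hf : rename (Equiv.swap i j) f = f) : divDiff i j f = 0 :=
  divDiff_eq hij (by simp [hf])

theorem divDiff_X_mul {i j m : Fin d} (hij : i ≠ j) (hi : m ≠ i) (hj : m ≠ j)
    (f : MvPolynomial (Fin d) ℝ) : divDiff i j (X m * f) = X m * divDiff i j f :=
  divDiff_eq hij (by
    rw [mul_left_comm, divDiff_spec, map_mul, rename_X, Equiv.swap_apply_of_ne_of_ne hi hj]; ring)

theorem divDiff_X_mul_right {i j : Fin d} (hij : i ≠ j) (f : MvPolynomial (Fin d) ℝ) :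
    divDiff i j (X j * f) = X j * divDiff i j f - rename (Equiv.swap i j) f :=
  divDiff_eq hij (by
    rw [mul_sub, mul_left_comm, divDiff_spec, map_mul, rename_X, Equiv.swap_apply_right]; ring)

theorem divDiff_X_mul_left {i j : Fin d} (hij : i ≠ j) (f : MvPolynomial (Fin d) ℝ) :
    divDiff i j (X i * f) = X i * divDiff i j f + rename (Equiv.swap i j) f :=
  divDiff_eq hij (by
    rw [mul_add, mul_left_comm, divDiff_spec, map_mul, rename_X, Equiv.swap_apply_left]; ring)

/-- The operator `2 x_i ∂_i + ∑_{j ≠ i} x_i / (x_i - x_j) (1 - s_{ij})`. -/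
noncomputable def heckmanOp (i : Fin d) :
    MvPolynomial (Fin d) ℝ →ₗ[ℝ] MvPolynomial (Fin d) ℝ where
  toFun f := 2 * (X i * pderiv i f) + ∑ j ∈ Finset.univ.erase i, X i * divDiff i j f
  map_add' f g := by
    have h : ∀ j ∈ Finset.univ.erase i, X i * divDiff i j (f + g) =
        X i * divDiff i j f + X i * divDiff i j g := fun j hj => by
      rw [divDiff_add (Finset.ne_of_mem_erase hj).symm, mul_add]
    rw [Finset.sum_congr rfl h, Finset.sum_add_distrib, map_add]
    ring
  map_smul' c f := by
    have h : ∀ j ∈ Finset.univ.erase i, X i * divDiff i j (c • f) =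
        c • (X i * divDiff i j f) := fun j hj => by
      rw [divDiff_smul (Finset.ne_of_mem_erase hj).symm, mul_smul_comm]
    rw [Finset.sum_congr rfl h, ← Finset.smul_sum, Derivation.map_smul, RingHom.id_apply,
      smul_add, mul_smul_comm, mul_smul_comm]

theorem heckmanOp_apply (i : Fin d) (f : MvPolynomial (Fin d) ℝ) :
    heckmanOp i f = 2 * (X i * pderiv i f) + ∑ j ∈ Finset.univ.erase i, X i * divDiff i j f :=
  rfl

/-- Equivariance under all permutations, which the Cherednik operators lose, lets the sum of squares
of these operators commute with symmetrization. -/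
theorem rename_heckmanOp (w : Equiv.Perm (Fin d)) (i : Fin d) (f : MvPolynomial (Fin d) ℝ) :
    rename w (heckmanOp i f) = heckmanOp (w i) (rename w f) := by
  rw [heckmanOp_apply, heckmanOp_apply, map_add, map_sum, pderiv_rename w.injective]
  congr 1
  · rw [map_mul, map_mul, rename_X, map_ofNat]
  · refine Finset.sum_equiv w (by simp) fun j hj => ?_
    rw [map_mul, rename_X, rename_divDiff (Finset.ne_of_mem_erase hj).symm]

theorem heckmanOp_of_isSymmetric (i : Fin d) {f : MvPolynomial (Fin d) ℝ} (hf : f.IsSymmetric) :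
    heckmanOp i f = 2 * (X i * pderiv i f) := by
  rw [heckmanOp_apply, Finset.sum_eq_zero, add_zero]
  intro j hj
  rw [divDiff_eq_zero (Finset.ne_of_mem_erase hj).symm (hf _), mul_zero]

theorem heckmanOp_X_mul {i m : Fin d} (him : i ≠ m) (f : MvPolynomial (Fin d) ℝ) :
    heckmanOp i (X m * f) = X m * heckmanOp i f - X i * rename (Equiv.swap i m) f := by
  have hm : m ∈ Finset.univ.erase i := by simp [him.symm]
  rw [heckmanOp_apply, heckmanOp_apply, ← Finset.add_sum_erase _ _ hm,
    ← Finset.add_sum_erase _ _ hm, divDiff_X_mul_right him]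
  have h : ∀ j ∈ (Finset.univ.erase i).erase m, X i * divDiff i j (X m * f) =
      X m * (X i * divDiff i j f) := fun j hj => by
    rw [Finset.mem_erase, Finset.mem_erase] at hj
    rw [divDiff_X_mul (Ne.symm hj.2.1) (Ne.symm him) (Ne.symm hj.1)]
    ring
  rw [Finset.sum_congr rfl h, ← Finset.mul_sum, Derivation.leibniz, pderiv_X_of_ne him.symm]
  simp only [smul_eq_mul, mul_zero, add_zero]
  ring

theorem heckmanOp_X_mul_self (i : Fin d) (f : MvPolynomial (Fin d) ℝ) :
    heckmanOp i (X i * f) = X i * (heckmanOp i f + 2 * f +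
      ∑ j ∈ Finset.univ.erase i, rename (Equiv.swap i j) f) := by
  have h : ∀ j ∈ Finset.univ.erase i, X i * divDiff i j (X i * f) =
      X i * (X i * divDiff i j f) + X i * rename (Equiv.swap i j) f := fun j hj => by
    rw [divDiff_X_mul_left (Finset.ne_of_mem_erase hj).symm]
    ring
  rw [heckmanOp_apply, heckmanOp_apply, Finset.sum_congr rfl h, Finset.sum_add_distrib,
    ← Finset.mul_sum, ← Finset.mul_sum, Derivation.leibniz, pderiv_X_self]
  simp only [smul_eq_mul, Finset.mul_sum, mul_add]
  ring_nf

end operators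

/-! ### Cherednik operators and the raising operator -/

section cherednik

variable {n : ℕ}

/-- The Cherednik operator `ξ_i = 2 x_i ∂_i + ∑_{j ≠ i} x_i / (x_i - x_j) (1 - s_{ij}) +
∑_{j > i} s_{ij} - n` in `n + 1` variables. -/
noncomputable def cherednikOp (i : Fin (n + 1)) :
    MvPolynomial (Fin (n + 1)) ℝ →ₗ[ℝ] MvPolynomial (Fin (n + 1)) ℝ :=
  heckmanOp i + ∑ j ∈ Finset.Ioi i, (rename (Equiv.swap i j)).toLinearMap -
    (n : ℝ) • LinearMap.id

theorem cherednikOp_apply (i : Fin (n + 1)) (f : MvPolynomial (Fin (n + 1)) ℝ) :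
    cherednikOp i f = heckmanOp i f + ∑ j ∈ Finset.Ioi i, rename (Equiv.swap i j) f -
      (n : ℝ) • f := by
  simp [cherednikOp]

/-- The transposition of `k` and `k + 1`. -/
def adjSwap (k : Fin n) : Equiv.Perm (Fin (n + 1)) := Equiv.swap k.castSucc k.succ

@[simp] theorem adjSwap_castSucc (k : Fin n) : adjSwap k k.castSucc = k.succ := by simp [adjSwap]

@[simp] theorem adjSwap_succ (k : Fin n) : adjSwap k k.succ = k.castSucc := by simp [adjSwap]

theorem adjSwap_of_ne {k : Fin n} {i : Fin (n + 1)} (h₁ : i ≠ k.castSucc) (h₂ : i ≠ k.succ) :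
    adjSwap k i = i := Equiv.swap_apply_of_ne_of_ne h₁ h₂

@[simp] theorem adjSwap_adjSwap (k : Fin n) (i : Fin (n + 1)) : adjSwap k (adjSwap k i) = i := by
  simp [adjSwap]

theorem adjSwap_lt_iff {k : Fin n} {i j : Fin (n + 1)}
    (h : ¬ (i = k.castSucc ∧ j = k.succ)) (h' : ¬ (i = k.succ ∧ j = k.castSucc)) :
    adjSwap k i < adjSwap k j ↔ i < j := by
  simp only [adjSwap, Equiv.swap_apply_def, Fin.ext_iff, Fin.lt_def] at *
  split_ifs <;> simp_all <;> omega

@[simp] theorem rename_adjSwap_rename_adjSwap (k : Fin n) (f : MvPolynomial (Fin (n + 1)) ℝ) :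
    rename (adjSwap k) (rename (adjSwap k) f) = f := by
  rw [rename_rename]
  have : (adjSwap k : Fin (n + 1) → Fin (n + 1)) ∘ adjSwap k = id := by ext i; simp
  rw [this, rename_id_apply]

theorem rename_adjSwap_cherednikOp_of_ne {k : Fin n} {i : Fin (n + 1)} (h₁ : i ≠ k.castSucc)
    (h₂ : i ≠ k.succ) (f : MvPolynomial (Fin (n + 1)) ℝ) :
    rename (adjSwap k) (cherednikOp i f) = cherednikOp i (rename (adjSwap k) f) := by
  rw [cherednikOp_apply, cherednikOp_apply, map_sub, map_add, map_sum, rename_heckmanOp,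
    map_smul, adjSwap_of_ne h₁ h₂]
  congr 2
  refine Finset.sum_equiv (adjSwap k) (fun j => ?_) fun j _ => ?_
  · rw [Finset.mem_Ioi, Finset.mem_Ioi]
    conv_rhs => rw [← adjSwap_of_ne h₁ h₂]
    exact (adjSwap_lt_iff (by tauto) (by tauto)).symm
  · rw [rename_swap_rename_perm, adjSwap_of_ne h₁ h₂]

/-- Of the transpositions in `ξ_k`, only `s_k` itself has no counterpart in `ξ_{k+1}`; since `s_k
s_k = 1`, it leaves the extra `f`. This is the degenerate affine Hecke relation. -/
theorem rename_adjSwap_cherednikOp_castSucc (k : Fin n) (f : MvPolynomial (Fin (n + 1)) ℝ) :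
    rename (adjSwap k) (cherednikOp k.castSucc f) =
      cherednikOp k.succ (rename (adjSwap k) f) + f := by
  have hmem : k.succ ∈ Finset.Ioi k.castSucc := by simp
  rw [cherednikOp_apply, cherednikOp_apply, map_sub, map_add, map_sum, rename_heckmanOp,
    map_smul, adjSwap_castSucc, ← Finset.add_sum_erase _ _ hmem]
  have h : ∑ j ∈ (Finset.Ioi k.castSucc).erase k.succ,
      rename (adjSwap k) (rename (Equiv.swap k.castSucc j) f) =
      ∑ j ∈ Finset.Ioi k.succ, rename (Equiv.swap k.succ j) (rename (adjSwap k) f) := by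
    refine Finset.sum_congr ?_ fun j hj => ?_
    · ext j
      simp only [Finset.mem_erase, Finset.mem_Ioi, Fin.lt_def, Ne, Fin.ext_iff, Fin.val_castSucc,
        Fin.val_succ]
      omega
    · have h1 : j ≠ k.castSucc := by rintro rfl; simp [Fin.lt_def] at hj
      have h2 : j ≠ k.succ := by rintro rfl; simp at hj
      rw [rename_swap_rename_perm, adjSwap_castSucc, adjSwap_of_ne h1 h2]
  rw [h]
  have h2 := rename_adjSwap_rename_adjSwap k f
  rw [show rename (Equiv.swap k.castSucc k.succ) f = rename (adjSwap k) f from rfl, h2]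
  abel

theorem rename_adjSwap_cherednikOp_succ (k : Fin n) (f : MvPolynomial (Fin (n + 1)) ℝ) :
    rename (adjSwap k) (cherednikOp k.succ f) =
      cherednikOp k.castSucc (rename (adjSwap k) f) - f := by
  have h := congrArg (rename (adjSwap k))
    (rename_adjSwap_cherednikOp_castSucc k (rename (adjSwap k) f))
  rw [map_add] at h
  simp only [rename_adjSwap_rename_adjSwap] at h
  rw [h, add_sub_cancel_right]

/-- The cyclic permutation `i + 1 ↦ i`, `0 ↦ n`. -/
def cycleDown : Equiv.Perm (Fin (n + 1)) := (finRotate (n + 1)).symm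

@[simp] theorem cycleDown_succ (i : Fin n) : cycleDown i.succ = i.castSucc := by
  rw [cycleDown, Equiv.symm_apply_eq]
  ext
  rw [coe_finRotate_of_ne_last (Fin.castSucc_lt_last i).ne]
  simp

@[simp] theorem cycleDown_zero : cycleDown (0 : Fin (n + 1)) = Fin.last n := by
  rw [cycleDown, Equiv.symm_apply_eq, finRotate_last]

/-- The raising operator `f(x_0, …, x_n) ↦ x_n f(x_n, x_0, …, x_{n-1})`. -/
noncomputable def raiseOp :
    MvPolynomial (Fin (n + 1)) ℝ →ₗ[ℝ] MvPolynomial (Fin (n + 1)) ℝ :=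
  LinearMap.mulLeft ℝ (X (Fin.last n)) ∘ₗ (rename cycleDown).toLinearMap

theorem raiseOp_apply (f : MvPolynomial (Fin (n + 1)) ℝ) :
    raiseOp f = X (Fin.last n) * rename cycleDown f := rfl

/-- Moving `x_n` past the Heckman operator costs `x_i s_{in}`, which is exactly the `j = n` term of
the transposition sum. With the companion for the last index, this makes raising send joint
eigenvectors to joint eigenvectors. -/
theorem cherednikOp_raiseOp_castSucc (i : Fin n) (f : MvPolynomial (Fin (n + 1)) ℝ) :
    cherednikOp i.castSucc (raiseOp f) = raiseOp (cherednikOp i.succ f) := by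
  have hne : i.castSucc ≠ Fin.last n := (Fin.castSucc_lt_last i).ne
  have hmem : Fin.last n ∈ Finset.Ioi i.castSucc := by simp [Fin.castSucc_lt_last]
  rw [cherednikOp_apply, cherednikOp_apply, raiseOp_apply, raiseOp_apply, heckmanOp_X_mul hne,
    map_sub, map_add, map_sum, rename_heckmanOp, map_smul, cycleDown_succ,
    ← Finset.add_sum_erase _ _ hmem]
  set g := rename cycleDown f
  have h : ∑ j ∈ (Finset.Ioi i.castSucc).erase (Fin.last n),
      rename (Equiv.swap i.castSucc j) (X (Fin.last n) * g) =
      ∑ j ∈ Finset.Ioi i.succ, X (Fin.last n) *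
        rename cycleDown (rename (Equiv.swap i.succ j) f) := by
    symm
    refine Finset.sum_equiv cycleDown (fun j => ?_) fun j hj => ?_
    · induction j using Fin.cases with
      | zero => simp
      | succ j => simp [(Fin.castSucc_lt_last j).ne]
    · have hj0 : j ≠ 0 := by rintro rfl; simp at hj
      obtain ⟨j, rfl⟩ := Fin.exists_succ_eq.2 hj0
      rw [rename_swap_rename_perm, cycleDown_succ, cycleDown_succ, map_mul, rename_X,
        Equiv.swap_apply_of_ne_of_ne hne.symm (Fin.castSucc_lt_last j).ne']
  rw [h, map_mul, rename_X, Equiv.swap_apply_right, ← Finset.mul_sum, mul_sub, mul_add,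
    mul_smul_comm]
  ring

/-- No transposition with `j > n` exists; those of `ξ_0` reappear from moving `x_n` past the divided
differences, and the shift by `2` comes from `2 x_n ∂_n`. -/
theorem cherednikOp_raiseOp_last (f : MvPolynomial (Fin (n + 1)) ℝ) :
    cherednikOp (Fin.last n) (raiseOp f) = raiseOp (cherednikOp 0 f + (2 : ℝ) • f) := by
  rw [cherednikOp_apply, cherednikOp_apply, raiseOp_apply, raiseOp_apply, heckmanOp_X_mul_self,
    map_add, map_sub, map_add, map_sum, rename_heckmanOp, map_smul, map_smul, cycleDown_zero]
  set g := rename cycleDown f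
  have h : ∑ j ∈ Finset.univ.erase (Fin.last n), rename (Equiv.swap (Fin.last n) j) g =
      ∑ j ∈ Finset.Ioi 0, rename cycleDown (rename (Equiv.swap 0 j) f) := by
    symm
    refine Finset.sum_equiv cycleDown (fun j => ?_) fun j hj => ?_
    · induction j using Fin.cases with
      | zero => simp
      | succ j => simp [(Fin.castSucc_lt_last j).ne]
    · rw [rename_swap_rename_perm, cycleDown_zero]
  rw [h, show Finset.Ioi (Fin.last n) = ∅ by ext j; simp [Fin.le_last], Finset.sum_empty,
    show (2 : MvPolynomial (Fin (n + 1)) ℝ) * g = (2 : ℝ) • g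
    by rw [smul_eq_C_mul, map_ofNat], mul_add, mul_add, mul_add, mul_sub, mul_add, mul_smul_comm,
    mul_smul_comm]
  abel

end cherednik

/-! ### Compositions: joint eigenvalues and the triangularity order -/

section compositions

variable {n : ℕ}

/-- `Precedes η j i`: the entry `η j` is larger than `η i`, or equal to it and further left. -/
def Precedes (η : Fin (n + 1) →₀ ℕ) (j i : Fin (n + 1)) : Prop :=
  η i < η j ∨ (η i = η j ∧ j < i)

instance (η : Fin (n + 1) →₀ ℕ) (j i : Fin (n + 1)) : Decidable (Precedes η j i) :=
  inferInstanceAs (Decidable (_ ∨ _))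

theorem Precedes.trans {η : Fin (n + 1) →₀ ℕ} {i j k : Fin (n + 1)} (h : Precedes η i j)
    (h' : Precedes η j k) : Precedes η i k := by
  unfold Precedes at *; omega

theorem not_precedes_self (η : Fin (n + 1) →₀ ℕ) (i : Fin (n + 1)) : ¬ Precedes η i i := by
  unfold Precedes; omega

theorem precedes_or_precedes (η : Fin (n + 1) →₀ ℕ) {i j : Fin (n + 1)} (h : i ≠ j) :
    Precedes η i j ∨ Precedes η j i := by
  unfold Precedes; omega

/-- The number of entries that precede the entry `i`. -/
def compRank (η : Fin (n + 1) →₀ ℕ) (i : Fin (n + 1)) : ℕ :=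
  (Finset.univ.filter fun j => Precedes η j i).card

theorem compRank_lt {η : Fin (n + 1) →₀ ℕ} {i j : Fin (n + 1)} (h : Precedes η j i) :
    compRank η j < compRank η i := by
  apply Finset.card_lt_card
  refine ⟨fun k hk => ?_, fun hs => ?_⟩
  · simp only [Finset.mem_filter, Finset.mem_univ, true_and] at hk ⊢
    exact hk.trans h
  · exact not_precedes_self η j (by simpa using hs (by simpa using h))

theorem compRank_equiv {η ν : Fin (n + 1) →₀ ℕ} (w : Equiv.Perm (Fin (n + 1)))
    (h : ∀ i j, Precedes ν (w j) (w i) ↔ Precedes η j i) (i : Fin (n + 1)) :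
    compRank ν (w i) = compRank η i := by
  symm
  refine Finset.card_equiv w fun j => ?_
  simp [h]

/-- The eigenvalue of the `i`-th Cherednik operator attached to the composition `η`. -/
noncomputable def jackChar (η : Fin (n + 1) →₀ ℕ) (i : Fin (n + 1)) : ℝ :=
  2 * η i - compRank η i

theorem jackChar_add_lt {η : Fin (n + 1) →₀ ℕ} {i j : Fin (n + 1)} (h : η i < η j) :
    jackChar η i + 2 < jackChar η j := by
  have h1 : (compRank η j : ℝ) < compRank η i := by exact_mod_cast compRank_lt (Or.inl h)
  have h2 : (η i : ℝ) + 1 ≤ η j := by exact_mod_cast h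
  unfold jackChar
  linarith

theorem jackChar_lt {η : Fin (n + 1) →₀ ℕ} {i j : Fin (n + 1)} (h : Precedes η j i) :
    jackChar η i < jackChar η j := by
  have h1 : (compRank η j : ℝ) < compRank η i := by exact_mod_cast compRank_lt h
  have h2 : (η i : ℝ) ≤ η j := by
    rcases h with h | h
    · exact_mod_cast h.le
    · exact_mod_cast h.1.le
  unfold jackChar
  linarith

theorem jackChar_lt_iff {η : Fin (n + 1) →₀ ℕ} {i j : Fin (n + 1)} :
    jackChar η i < jackChar η j ↔ Precedes η j i := by
  refine ⟨fun h => ?_, jackChar_lt⟩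
  by_contra hc
  rcases eq_or_ne i j with rfl | hij
  · exact lt_irrefl _ h
  · exact lt_asymm h (jackChar_lt ((precedes_or_precedes η hij).resolve_right hc))

/-- The order of the eigenvalues recovers `Precedes`, hence the ranks, and then the entries
themselves. -/
theorem jackChar_injective : Function.Injective (jackChar (n := n)) := by
  intro η ν h
  have hr : ∀ i, compRank η i = compRank ν i := fun i => by
    unfold compRank
    congr 1
    ext j
    simp only [Finset.mem_filter, Finset.mem_univ, true_and]
    rw [← jackChar_lt_iff, ← jackChar_lt_iff, h]
  ext i
  have := congrFun h i
  unfold jackChar at this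
  rw [hr i] at this
  have h2 : (η i : ℝ) = ν i := by linarith
  exact_mod_cast h2

theorem jackChar_zero (i : Fin (n + 1)) : jackChar (0 : Fin (n + 1) →₀ ℕ) i = -(i : ℕ) := by
  have : compRank (0 : Fin (n + 1) →₀ ℕ) i = i := by
    have h : (Finset.univ.filter fun j => Precedes (0 : Fin (n + 1) →₀ ℕ) j i) = Finset.Iio i := by
      ext j; simp [Precedes]
    rw [compRank, h, Fin.card_Iio]
  simp [jackChar, this]

/-- The composition `(η_1, …, η_n, η_0 + 1)`. -/
noncomputable def raiseExp (η : Fin (n + 1) →₀ ℕ) : Fin (n + 1) →₀ ℕ :=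
  η.mapDomain cycleDown + Finsupp.single (Fin.last n) 1

theorem mapDomain_perm_apply (w : Equiv.Perm (Fin (n + 1))) (η : Fin (n + 1) →₀ ℕ)
    (i : Fin (n + 1)) : η.mapDomain w (w i) = η i :=
  Finsupp.mapDomain_apply w.injective η i

theorem raiseExp_castSucc (η : Fin (n + 1) →₀ ℕ) (i : Fin n) :
    raiseExp η i.castSucc = η i.succ := by
  rw [raiseExp, Finsupp.add_apply, ← cycleDown_succ, mapDomain_perm_apply]
  simp [(Fin.castSucc_lt_last i).ne]

theorem raiseExp_last (η : Fin (n + 1) →₀ ℕ) : raiseExp η (Fin.last n) = η 0 + 1 := by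
  rw [raiseExp, Finsupp.add_apply]
  nth_rw 1 [← cycleDown_zero]
  rw [mapDomain_perm_apply]
  simp

theorem degree_raiseExp (η : Fin (n + 1) →₀ ℕ) : (raiseExp η).degree = η.degree + 1 := by
  rw [raiseExp, map_add, Finsupp.degree_single, Finsupp.degree_mapDomain]

theorem exists_raiseExp_eq {η : Fin (n + 1) →₀ ℕ} (h : 0 < η (Fin.last n)) :
    ∃ ν, raiseExp ν = η := by
  refine ⟨(η - Finsupp.single (Fin.last n) 1).mapDomain cycleDown.symm, ?_⟩
  rw [raiseExp, ← Finsupp.mapDomain_comp]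
  simp only [Equiv.self_comp_symm, Finsupp.mapDomain_id]
  exact tsub_add_cancel_of_le (by simpa using Nat.succ_le_of_lt h)

theorem precedes_raiseExp (η : Fin (n + 1) →₀ ℕ) (i j : Fin (n + 1)) :
    Precedes (raiseExp η) (cycleDown j) (cycleDown i) ↔ Precedes η j i := by
  unfold Precedes
  induction i using Fin.cases with
  | zero =>
    induction j using Fin.cases with
    | zero => simp
    | succ j =>
      simp only [cycleDown_zero, cycleDown_succ, raiseExp_last, raiseExp_castSucc,
        Fin.castSucc_lt_last, and_true, Fin.not_lt_zero, and_false, or_false]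
      omega
  | succ i =>
    induction j using Fin.cases with
    | zero =>
      simp only [cycleDown_zero, cycleDown_succ, raiseExp_last, raiseExp_castSucc,
        Fin.succ_pos, and_true, (Fin.castSucc_lt_last i).not_gt, and_false, or_false]
      omega
    | succ j => simp [raiseExp_castSucc]

theorem jackChar_raiseExp_castSucc (η : Fin (n + 1) →₀ ℕ) (i : Fin n) :
    jackChar (raiseExp η) i.castSucc = jackChar η i.succ := by
  have h := compRank_equiv cycleDown (precedes_raiseExp η) i.succ
  rw [cycleDown_succ] at h
  rw [jackChar, jackChar, h, raiseExp_castSucc]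

theorem jackChar_raiseExp_last (η : Fin (n + 1) →₀ ℕ) :
    jackChar (raiseExp η) (Fin.last n) = jackChar η 0 + 2 := by
  have h := compRank_equiv cycleDown (precedes_raiseExp η) 0
  rw [cycleDown_zero] at h
  rw [jackChar, jackChar, h, raiseExp_last]
  push_cast
  ring

/-- The composition with the entries `k` and `k + 1` exchanged. -/
noncomputable def swapExp (k : Fin n) (η : Fin (n + 1) →₀ ℕ) : Fin (n + 1) →₀ ℕ :=
  η.mapDomain (adjSwap k)

theorem swapExp_apply (k : Fin n) (η : Fin (n + 1) →₀ ℕ) (i : Fin (n + 1)) :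
    swapExp k η i = η (adjSwap k i) := by
  rw [swapExp]
  conv_lhs => rw [← adjSwap_adjSwap k i]
  rw [mapDomain_perm_apply]

@[simp] theorem swapExp_swapExp (k : Fin n) (η : Fin (n + 1) →₀ ℕ) :
    swapExp k (swapExp k η) = η := by
  ext i; simp [swapExp_apply]

theorem degree_swapExp (k : Fin n) (η : Fin (n + 1) →₀ ℕ) : (swapExp k η).degree = η.degree := by
  rw [swapExp, Finsupp.degree_mapDomain]

theorem precedes_swapExp {k : Fin n} {η : Fin (n + 1) →₀ ℕ} (h : η k.castSucc ≠ η k.succ)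
    (i j : Fin (n + 1)) :
    Precedes (swapExp k η) (adjSwap k j) (adjSwap k i) ↔ Precedes η j i := by
  unfold Precedes
  rw [swapExp_apply, swapExp_apply, adjSwap_adjSwap, adjSwap_adjSwap]
  by_cases h1 : j = k.castSucc ∧ i = k.succ
  · obtain ⟨rfl, rfl⟩ := h1
    simp [h.symm]
  by_cases h2 : j = k.succ ∧ i = k.castSucc
  · obtain ⟨rfl, rfl⟩ := h2
    simp [h]
  rw [adjSwap_lt_iff h1 h2]

theorem jackChar_swapExp {k : Fin n} {η : Fin (n + 1) →₀ ℕ} (h : η k.castSucc ≠ η k.succ)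
    (i : Fin (n + 1)) : jackChar (swapExp k η) i = jackChar η (adjSwap k i) := by
  have h := compRank_equiv (adjSwap k) (precedes_swapExp h) (adjSwap k i)
  rw [adjSwap_adjSwap] at h
  rw [jackChar, jackChar, h, swapExp_apply]

/-- The sum of the excesses over `T` of the entries, the first `a` of them increased by `1`. -/
def excess (s : Fin (n + 1) →₀ ℕ) (T a : ℕ) : ℕ :=
  ∑ i : Fin (n + 1), (s i + (if (i : ℕ) < a then 1 else 0) - T)

/-- The order on compositions of the same degree for which nonsymmetric Jack polynomials are
triangular. -/
def CompLE (s η : Fin (n + 1) →₀ ℕ) : Prop :=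
  s.degree = η.degree ∧ ∀ T a, a ≤ n + 1 → excess s T a ≤ excess η T a

theorem CompLE.refl (s : Fin (n + 1) →₀ ℕ) : CompLE s s := ⟨rfl, fun _ _ _ => le_rfl⟩

theorem excess_succ (s : Fin (n + 1) →₀ ℕ) (T : ℕ) (k : Fin (n + 1)) :
    excess s T (k + 1) = excess s T k + if T ≤ s k then 1 else 0 := by
  have h : (if T ≤ s k then 1 else 0) = ∑ i, if i = k then (if T ≤ s k then 1 else 0) else 0 := by
    simp
  rw [h, excess, excess, ← Finset.sum_add_distrib]
  refine Finset.sum_congr rfl fun i _ => ?_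
  rcases eq_or_ne i k with rfl | hik
  · simp; split_ifs <;> omega
  · have : (i : ℕ) ≠ k := fun h => hik (Fin.ext h)
    rw [if_neg hik]
    split_ifs <;> omega

theorem excess_swapExp (s : Fin (n + 1) →₀ ℕ) (T : ℕ) {a : ℕ} {k : Fin n} (ha : a ≠ k + 1) :
    excess (swapExp k s) T a = excess s T a := by
  unfold excess
  rw [← Equiv.sum_comp (adjSwap k)]
  refine Finset.sum_congr rfl fun i _ => ?_
  have : ((adjSwap k i : Fin (n + 1)) : ℕ) < a ↔ (i : ℕ) < a := by
    rcases eq_or_ne i k.castSucc with rfl | h1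
    · simp; omega
    rcases eq_or_ne i k.succ with rfl | h2
    · simp; omega
    rw [adjSwap_of_ne h1 h2]
  rw [swapExp_apply, adjSwap_adjSwap]
  simp only [this]

theorem excess_swapExp_succ (s : Fin (n + 1) →₀ ℕ) (T : ℕ) (k : Fin n) :
    excess (swapExp k s) T (k + 1) = excess s T k + if T ≤ s k.succ then 1 else 0 := by
  have h := excess_succ (swapExp k s) T k.castSucc
  rw [swapExp_apply, adjSwap_castSucc, Fin.val_castSucc,
    excess_swapExp s T (show (k : ℕ) ≠ k + 1 by omega)] at h
  exact h

theorem CompLE.swapExp_right {s η : Fin (n + 1) →₀ ℕ} (h : CompLE s η) {k : Fin n}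
    (hk : η k.castSucc < η k.succ) : CompLE s (swapExp k η) := by
  refine ⟨h.1.trans (degree_swapExp k η).symm, fun T a ha => ?_⟩
  rcases eq_or_ne a (k + 1) with rfl | hak
  · refine (h.2 T _ ha).trans ?_
    have h1 := excess_succ η T k.castSucc
    rw [Fin.val_castSucc] at h1
    rw [excess_swapExp_succ, h1]
    split_ifs <;> omega
  · rw [excess_swapExp η T hak]
    exact h.2 T a ha

/-- Only the level `a = k + 1` is affected. If `T ≤ η k.succ`, the bound at level `k` suffices, an
increment being at most `1`. Otherwise `η` has no increment between levels `k` and `k + 2`, and the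
bound at level `k + 2` suffices. -/
theorem CompLE.swapExp_swapExp {s η : Fin (n + 1) →₀ ℕ} (h : CompLE s η) {k : Fin n}
    (hk : η k.castSucc < η k.succ) : CompLE (swapExp k s) (swapExp k η) := by
  refine ⟨by rw [degree_swapExp, degree_swapExp, h.1], fun T a ha => ?_⟩
  rcases eq_or_ne a (k + 1) with rfl | hak
  · have h1 := excess_succ η T k.castSucc
    have h2 := excess_succ η T k.succ
    have h3 := excess_succ s T k.castSucc
    have h4 := excess_succ s T k.succ
    have h5 := h.2 T k (by omega)
    have h6 := h.2 T (k + 1 + 1) (by omega)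
    simp only [Fin.val_castSucc, Fin.val_succ] at h1 h2 h3 h4
    rw [excess_swapExp_succ, excess_swapExp_succ]
    split_ifs at * <;> omega
  · rw [excess_swapExp _ T hak, excess_swapExp _ T hak]
    exact h.2 T a ha

theorem excess_raiseExp (s : Fin (n + 1) →₀ ℕ) (T : ℕ) {a : ℕ} (ha : a ≤ n) :
    excess (raiseExp s) T a = excess s T (a + 1) := by
  unfold excess
  rw [← Equiv.sum_comp cycleDown]
  refine Finset.sum_congr rfl fun i _ => ?_
  induction i using Fin.cases with
  | zero => simp [raiseExp_last, ha.not_gt]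
  | succ i => simp [raiseExp_castSucc]

theorem excess_raiseExp_top (s : Fin (n + 1) →₀ ℕ) (T : ℕ) :
    excess (raiseExp s) (T + 1) (n + 1) = excess s T 1 := by
  unfold excess
  rw [← Equiv.sum_comp cycleDown]
  refine Finset.sum_congr rfl fun i _ => ?_
  induction i using Fin.cases with
  | zero => simp [raiseExp_last]
  | succ i => simp [raiseExp_castSucc]

theorem excess_zero_left (s : Fin (n + 1) →₀ ℕ) (a : ℕ) :
    excess s 0 a = s.degree + ∑ i : Fin (n + 1), if (i : ℕ) < a then 1 else 0 := by
  rw [Finsupp.degree_eq_sum, ← Finset.sum_add_distrib]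
  rfl

/-- Raising moves level `a + 1` to level `a`, and level `1` at `T` to level `n + 1` at `T + 1`.
Hence the order must compare all levels `a`, although only `a = 0` is used after symmetrization. -/
theorem CompLE.raiseExp {s η : Fin (n + 1) →₀ ℕ} (h : CompLE s η) :
    CompLE (raiseExp s) (raiseExp η) := by
  have hd : (_root_.raiseExp s).degree = (_root_.raiseExp η).degree := by
    rw [degree_raiseExp, degree_raiseExp, h.1]
  refine ⟨hd, fun T a ha => ?_⟩
  rcases Nat.lt_or_ge n a with h1 | h1
  · obtain rfl : a = n + 1 := by omega
    cases T with
    | zero => rw [excess_zero_left, excess_zero_left, hd]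
    | succ T =>
      rw [excess_raiseExp_top, excess_raiseExp_top]
      exact h.2 T 1 (by omega)
  · rw [excess_raiseExp _ T h1, excess_raiseExp _ T h1]
    exact h.2 T _ (by omega)

end compositions

/-! ### Construction of nonsymmetric Jack polynomials -/

section nonsymmetric

variable {n : ℕ}

theorem coeff_rename_perm (w : Equiv.Perm (Fin (n + 1))) (s : Fin (n + 1) →₀ ℕ)
    (f : MvPolynomial (Fin (n + 1)) ℝ) :
    coeff (s.mapDomain w) (rename w f) = coeff s f :=
  coeff_rename_mapDomain w w.injective f s

theorem coeff_rename_adjSwap (k : Fin n) (s : Fin (n + 1) →₀ ℕ)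
    (f : MvPolynomial (Fin (n + 1)) ℝ) :
    coeff s (rename (adjSwap k) f) = coeff (swapExp k s) f := by
  have h := coeff_rename_perm (adjSwap k) (swapExp k s) f
  rwa [show (swapExp k s).mapDomain (adjSwap k) = s from swapExp_swapExp k s] at h

theorem coeff_raiseExp_raiseOp (s : Fin (n + 1) →₀ ℕ) (f : MvPolynomial (Fin (n + 1)) ℝ) :
    coeff (raiseExp s) (raiseOp f) = coeff s f := by
  rw [raiseExp, raiseOp_apply, add_comm (Finsupp.mapDomain _ _), coeff_X_mul, coeff_rename_perm]

theorem coeff_raiseOp_of_eq_zero {s : Fin (n + 1) →₀ ℕ} (hs : s (Fin.last n) = 0)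
    (f : MvPolynomial (Fin (n + 1)) ℝ) : coeff s (raiseOp f) = 0 := by
  rw [raiseOp_apply, coeff_X_mul', if_neg (by simpa using hs)]

/-- `E` is a (positive multiple of a) nonsymmetric Jack polynomial of the composition `η`. -/
structure IsNonsymJack (η : Fin (n + 1) →₀ ℕ) (E : MvPolynomial (Fin (n + 1)) ℝ) : Prop where
  nonneg : ∀ s, 0 ≤ coeff s E
  pos : 0 < coeff η E
  eigen : ∀ i, cherednikOp i E = jackChar η i • E
  triangular : ∀ s, coeff s E ≠ 0 → CompLE s η

theorem isNonsymJack_one : IsNonsymJack (0 : Fin (n + 1) →₀ ℕ) 1 where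
  nonneg s := by rw [coeff_one]; split_ifs <;> norm_num
  pos := by simp
  eigen i := by
    have h : ∀ j ∈ Finset.univ.erase i, X i * divDiff i j (1 : MvPolynomial (Fin (n + 1)) ℝ) = 0 :=
      fun j hj => by
        rw [divDiff_eq_zero (Finset.ne_of_mem_erase hj).symm (map_one _), mul_zero]
    rw [cherednikOp_apply, heckmanOp_apply, Finset.sum_eq_zero h, jackChar_zero, pderiv_one]
    simp only [map_one, Finset.sum_const, Fin.card_Ioi, mul_zero, add_zero, zero_add]
    rw [Nat.smul_one_eq_cast, ← map_natCast (C (σ := Fin (n + 1)) (R := ℝ)), smul_eq_C_mul,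
      smul_eq_C_mul, mul_one, mul_one, ← C_sub]
    congr 1
    have : (i : ℕ) ≤ n := by omega
    rw [show n + 1 - 1 - (i : ℕ) = n - i by omega]
    push_cast [this]
    ring
  triangular s hs := by
    rw [coeff_one] at hs
    obtain rfl : 0 = s := by by_contra h; simp [h] at hs
    exact CompLE.refl 0

theorem IsNonsymJack.raise {η : Fin (n + 1) →₀ ℕ} {E : MvPolynomial (Fin (n + 1)) ℝ}
    (h : IsNonsymJack η E) : IsNonsymJack (raiseExp η) (raiseOp E) where
  nonneg s := by
    rcases Nat.eq_zero_or_pos (s (Fin.last n)) with hs | hs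
    · rw [coeff_raiseOp_of_eq_zero hs]
    · obtain ⟨ν, rfl⟩ := exists_raiseExp_eq hs
      rw [coeff_raiseExp_raiseOp]
      exact h.nonneg ν
  pos := by
    rw [coeff_raiseExp_raiseOp]
    exact h.pos
  eigen i := by
    induction i using Fin.lastCases with
    | last => rw [cherednikOp_raiseOp_last, h.eigen, jackChar_raiseExp_last, ← add_smul, map_smul]
    | cast i =>
      rw [cherednikOp_raiseOp_castSucc, h.eigen, jackChar_raiseExp_castSucc, map_smul]
  triangular s hs := by
    rcases Nat.eq_zero_or_pos (s (Fin.last n)) with h0 | h0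
    · exact absurd (coeff_raiseOp_of_eq_zero h0 E) hs
    · obtain ⟨ν, rfl⟩ := exists_raiseExp_eq h0
      rw [coeff_raiseExp_raiseOp] at hs
      exact (h.triangular ν hs).raiseExp

/-- The coefficient in the intertwining relation `E_{s_k η} = s_k E_η + c E_η`. -/
noncomputable def swapCoeff (k : Fin n) (η : Fin (n + 1) →₀ ℕ) : ℝ :=
  (jackChar η k.succ - jackChar η k.castSucc)⁻¹

theorem swapCoeff_pos {k : Fin n} {η : Fin (n + 1) →₀ ℕ} (h : η k.castSucc < η k.succ) :
    0 < swapCoeff k η := by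
  have := jackChar_add_lt h
  exact inv_pos.2 (by linarith)

theorem swapCoeff_lt_one {k : Fin n} {η : Fin (n + 1) →₀ ℕ} (h : η k.castSucc < η k.succ) :
    swapCoeff k η < 1 := by
  have := jackChar_add_lt h
  exact inv_lt_one_of_one_lt₀ (by linarith)

theorem swapCoeff_mul {k : Fin n} {η : Fin (n + 1) →₀ ℕ} (h : η k.castSucc < η k.succ) :
    swapCoeff k η * jackChar η k.succ = 1 + swapCoeff k η * jackChar η k.castSucc := by
  have := jackChar_add_lt h
  have h0 : jackChar η k.succ - jackChar η k.castSucc ≠ 0 := by intro h; linarith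
  unfold swapCoeff
  field_simp
  ring

/-- The Hecke relations make `s_k + c` an intertwiner exactly when `c` is the inverse gap between
the two eigenvalues. The ascent `η_k < η_{k+1}` makes `c` positive, so nonnegativity survives. -/
theorem IsNonsymJack.swap {η : Fin (n + 1) →₀ ℕ} {E : MvPolynomial (Fin (n + 1)) ℝ}
    (h : IsNonsymJack η E) {k : Fin n} (hk : η k.castSucc < η k.succ) :
    IsNonsymJack (swapExp k η) (rename (adjSwap k) E + swapCoeff k η • E) where
  nonneg s := by
    rw [coeff_add, coeff_smul, coeff_rename_adjSwap]
    exact add_nonneg (h.nonneg _) (mul_nonneg (swapCoeff_pos hk).le (h.nonneg _))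
  pos := by
    rw [coeff_add, coeff_smul, coeff_rename_adjSwap, swapExp_swapExp]
    exact add_pos_of_pos_of_nonneg h.pos (mul_nonneg (swapCoeff_pos hk).le (h.nonneg _))
  eigen i := by
    have hc := swapCoeff_mul hk
    rw [jackChar_swapExp hk.ne, map_add, map_smul, h.eigen]
    rcases eq_or_ne i k.castSucc with rfl | h1
    · have h2 := rename_adjSwap_cherednikOp_succ k E
      rw [h.eigen, map_smul] at h2
      rw [eq_add_of_sub_eq h2.symm, adjSwap_castSucc, smul_add, smul_smul, smul_smul,
        mul_comm (jackChar η k.succ), hc, add_smul, one_smul, add_assoc]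
    rcases eq_or_ne i k.succ with rfl | h2
    · have h2 := rename_adjSwap_cherednikOp_castSucc k E
      rw [h.eigen, map_smul] at h2
      rw [eq_sub_of_add_eq h2.symm, adjSwap_succ, smul_add, smul_smul, smul_smul, hc,
        mul_comm (jackChar η k.castSucc), add_smul, one_smul]
      abel
    · rw [← rename_adjSwap_cherednikOp_of_ne h1 h2, h.eigen, map_smul, adjSwap_of_ne h1 h2,
        smul_add, smul_smul, smul_smul, mul_comm]
  triangular s hs := by
    rw [coeff_add, coeff_smul, coeff_rename_adjSwap] at hs
    by_cases h0 : coeff s E = 0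
    · rw [h0, smul_zero, add_zero] at hs
      simpa using (h.triangular _ hs).swapExp_swapExp hk
    · exact (h.triangular s h0).swapExp_right hk

/-- The weighted size `∑ i, i η_i`. -/
def weightedSize (η : Fin (n + 1) →₀ ℕ) : ℕ := ∑ i : Fin (n + 1), i * η i

theorem weightedSize_swapExp_lt {η : Fin (n + 1) →₀ ℕ} {k : Fin n}
    (hk : η k.castSucc < η k.succ) : weightedSize (swapExp k η) < weightedSize η := by
  have hmem : k.succ ∈ Finset.univ.erase k.castSucc := by simp [Fin.ext_iff]
  have h : ∀ ν : Fin (n + 1) →₀ ℕ, weightedSize ν = k * ν k.castSucc + ((k + 1) * ν k.succ +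
      ∑ i ∈ (Finset.univ.erase k.castSucc).erase k.succ, i * ν i) := fun ν => by
    rw [weightedSize, ← Finset.add_sum_erase _ _ (Finset.mem_univ k.castSucc),
      ← Finset.add_sum_erase _ _ hmem]
    simp
  have h2 : ∑ i ∈ (Finset.univ.erase k.castSucc).erase k.succ, (i : ℕ) * swapExp k η i =
      ∑ i ∈ (Finset.univ.erase k.castSucc).erase k.succ, i * η i := by
    refine Finset.sum_congr rfl fun i hi => ?_
    simp only [Finset.mem_erase, Finset.mem_univ, and_true] at hi
    rw [swapExp_apply, adjSwap_of_ne hi.2 hi.1]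
  rw [h, h, h2, swapExp_apply, swapExp_apply, adjSwap_castSucc, adjSwap_succ]
  nlinarith

theorem weightedSize_le (η : Fin (n + 1) →₀ ℕ) : weightedSize η ≤ n * η.degree := by
  rw [weightedSize, Finsupp.degree_eq_sum, Finset.mul_sum]
  exact Finset.sum_le_sum fun i _ => Nat.mul_le_mul_right _ (by omega)

/-- A positive last entry is removed by undoing a raise. A zero last entry forces a descent, and
undoing that swap moves weight to the right, which `weightedSize_le` allows only finitely often. -/
theorem exists_isNonsymJack (η : Fin (n + 1) →₀ ℕ) : ∃ E, IsNonsymJack η E := by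
  suffices h : ∀ K M (η : Fin (n + 1) →₀ ℕ), η.degree = K → n * K - weightedSize η = M →
      ∃ E, IsNonsymJack η E from h _ _ η rfl rfl
  intro K
  induction K with
  | zero =>
    intro M η h0 _
    rw [(Finsupp.degree_eq_zero_iff η).1 h0]
    exact ⟨1, isNonsymJack_one⟩
  | succ K ih =>
    intro M
    induction M using Nat.strong_induction_on with
    | _ M ihM =>
    intro η hK hM
    rcases Nat.eq_zero_or_pos (η (Fin.last n)) with h0 | h0
    · have hk : ∃ k : Fin n, η k.succ < η k.castSucc := by
        by_contra! hc
        have hmono : Monotone η := Fin.monotone_iff_le_succ.2 hc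
        have : η = 0 := by
          ext i
          have := hmono (Fin.le_last i)
          simp; omega
        simp [this] at hK
      obtain ⟨k, hk⟩ := hk
      have hk' : swapExp k η k.castSucc < swapExp k η k.succ := by simpa [swapExp_apply] using hk
      have hw := weightedSize_swapExp_lt hk'
      have hle := weightedSize_le (swapExp k η)
      rw [swapExp_swapExp] at hw
      rw [degree_swapExp, hK] at hle
      obtain ⟨E, hE⟩ := ihM _ (by omega) (swapExp k η) (by rw [degree_swapExp, hK]) rfl
      exact ⟨_, by simpa using hE.swap hk'⟩
    · obtain ⟨ν, rfl⟩ := exists_raiseExp_eq h0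
      rw [degree_raiseExp, add_left_inj] at hK
      obtain ⟨E, hE⟩ := ih _ ν hK rfl
      exact ⟨_, hE.raise⟩

end nonsymmetric

/-! ### The basis of nonsymmetric Jack polynomials and its coordinates -/

theorem linearIndependent_of_joint_eigenvectors {K V ι κ : Type*} [Field K] [AddCommGroup V]
    [Module K V] (T : κ → V →ₗ[K] V) (χ : ι → κ → K) (hχ : Function.Injective χ) (v : ι → V)
    (hv : ∀ i, v i ≠ 0) (h : ∀ i j, T j (v i) = χ i j • v i) : LinearIndependent K v := by
  classical
  rw [linearIndependent_iff']
  intro s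
  induction s using Finset.induction_on with
  | empty => simp
  | insert m s hm ih =>
    intro g hg
    rw [Finset.sum_insert hm] at hg
    have hs : ∀ i ∈ s, g i = 0 := by
      intro i hi
      obtain ⟨j, hj⟩ : ∃ j, χ i j ≠ χ m j := by
        by_contra! hc
        exact hm (hχ (funext hc) ▸ hi)
      have h1 := congrArg (T j) hg
      have h2 := congrArg (χ m j • ·) hg
      simp only [map_add, map_sum, map_smul, h, map_zero, smul_add, Finset.smul_sum,
        smul_zero] at h1 h2
      -- Applying `T j` and subtracting `χ m j` times the relation eliminates `v m`.
      have h3 : ∑ i ∈ s, (g i * (χ i j - χ m j)) • v i = 0 := by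
        simp only [mul_sub, sub_smul, Finset.sum_sub_distrib, mul_smul]
        rw [smul_comm] at h1
        simp only [smul_comm (χ m j) (g _)] at h1 h2
        rw [sub_eq_zero]
        exact add_left_cancel (h1.trans h2.symm)
      exact (mul_eq_zero.1 (ih _ h3 i hi)).resolve_right (sub_ne_zero.2 hj)
    intro i hi
    rcases Finset.mem_insert.1 hi with rfl | hi
    · rw [Finset.sum_eq_zero fun i hi => by rw [hs i hi, zero_smul], add_zero] at hg
      exact (smul_eq_zero.1 hg).resolve_right (hv i)
    · exact hs i hi

section jackBasis

variable {n : ℕ}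

/-- A nonsymmetric Jack polynomial of the composition `η`, with positive leading coefficient. -/
noncomputable def nonsymJack (η : Fin (n + 1) →₀ ℕ) : MvPolynomial (Fin (n + 1)) ℝ :=
  Classical.choose (exists_isNonsymJack η)

theorem isNonsymJack_nonsymJack (η : Fin (n + 1) →₀ ℕ) : IsNonsymJack η (nonsymJack η) :=
  Classical.choose_spec (exists_isNonsymJack η)

theorem nonsymJack_ne_zero (η : Fin (n + 1) →₀ ℕ) : nonsymJack η ≠ 0 := fun h => by
  have := (isNonsymJack_nonsymJack η).pos
  simp [h] at this

theorem linearIndependent_nonsymJack :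
    LinearIndependent ℝ (nonsymJack : (Fin (n + 1) →₀ ℕ) → _) :=
  linearIndependent_of_joint_eigenvectors cherednikOp jackChar jackChar_injective _
    nonsymJack_ne_zero fun η => (isNonsymJack_nonsymJack η).eigen

theorem IsNonsymJack.isHomogeneous {η : Fin (n + 1) →₀ ℕ} {E : MvPolynomial (Fin (n + 1)) ℝ}
    (h : IsNonsymJack η E) : E.IsHomogeneous η.degree := by
  intro s hs
  rw [show (1 : Fin (n + 1) → ℕ) = fun _ => 1 from rfl, ← Finsupp.degree_eq_weight_one]
  exact (h.triangular s hs).1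

/-- The compositions of `k`, as exponent vectors. -/
noncomputable def compositions (n k : ℕ) : Finset (Fin (n + 1) →₀ ℕ) :=
  (Finsupp.finite_of_degree_eq k).toFinset

@[simp] theorem mem_compositions {k : ℕ} {η : Fin (n + 1) →₀ ℕ} :
    η ∈ compositions n k ↔ η.degree = k := by
  simp [compositions]

/-- Independence suffices by a dimension count: the compositions of `k` index both the monomials of
degree `k` and the Jack polynomials of that degree. -/
theorem mem_span_nonsymJack {k : ℕ} {f : MvPolynomial (Fin (n + 1)) ℝ} (hf : f.IsHomogeneous k) :
    f ∈ Submodule.span ℝ (nonsymJack '' (compositions n k : Set (Fin (n + 1) →₀ ℕ))) := by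
  let V := homogeneousSubmodule (Fin (n + 1)) ℝ k
  let e : V ≃ₗ[ℝ] ({d : Fin (n + 1) →₀ ℕ | d.degree = k} →₀ ℝ) :=
    (LinearEquiv.ofEq _ _ (homogeneousSubmodule_eq_finsupp_supported _ _ _)).trans
      (AddMonoidAlgebra.supportedEquivFinsupp _)
  have hfin : Finite {d : Fin (n + 1) →₀ ℕ | d.degree = k} := Finsupp.finite_of_degree_eq k
  have := Fintype.ofFinite {d : Fin (n + 1) →₀ ℕ | d.degree = k}
  have hV : FiniteDimensional ℝ V := Module.Finite.equiv e.symm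
  let b : {d : Fin (n + 1) →₀ ℕ | d.degree = k} → V := fun η =>
    ⟨nonsymJack η.1, by
      have := (isNonsymJack_nonsymJack η.1).isHomogeneous
      rwa [show η.1.degree = k from η.2] at this⟩
  have hb : LinearIndependent ℝ b := by
    have h1 := linearIndependent_nonsymJack.comp
      (Subtype.val : {d : Fin (n + 1) →₀ ℕ | d.degree = k} → _) Subtype.val_injective
    exact LinearIndependent.of_comp V.subtype h1
  have hspan := hb.span_eq_top_of_card_eq_finrank' (by
    rw [e.finrank_eq, Module.finrank_finsupp_self])
  have h2 : (⟨f, hf⟩ : V) ∈ Submodule.span ℝ (Set.range b) := by rw [hspan]; trivial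
  have h3 := Submodule.mem_map_of_mem (f := V.subtype) h2
  rw [Submodule.map_span, ← Set.range_comp] at h3
  refine Submodule.span_mono ?_ h3
  rintro _ ⟨η, rfl⟩
  exact ⟨η.1, mem_compositions.2 η.2, rfl⟩

/-- The basis of the polynomial ring formed by the nonsymmetric Jack polynomials. -/
noncomputable def jackBasis : Module.Basis (Fin (n + 1) →₀ ℕ) ℝ (MvPolynomial (Fin (n + 1)) ℝ) :=
  Module.Basis.mk linearIndependent_nonsymJack fun f _ => by
    rw [← sum_homogeneousComponent f]
    refine Submodule.sum_mem _ fun k _ => ?_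
    exact Submodule.span_mono (Set.image_subset_range _ _)
      (mem_span_nonsymJack (homogeneousComponent_isHomogeneous k f))

@[simp] theorem jackBasis_apply (η : Fin (n + 1) →₀ ℕ) : jackBasis η = nonsymJack η := by
  simp [jackBasis]

/-- The coordinate with respect to the basis of nonsymmetric Jack polynomials. -/
noncomputable def jackCoord (η : Fin (n + 1) →₀ ℕ) : MvPolynomial (Fin (n + 1)) ℝ →ₗ[ℝ] ℝ :=
  jackBasis.coord η

theorem jackCoord_nonsymJack (η ν : Fin (n + 1) →₀ ℕ) :
    jackCoord η (nonsymJack ν) = if ν = η then 1 else 0 := by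
  classical
  rw [← jackBasis_apply, jackCoord, Module.Basis.coord_apply, Module.Basis.repr_self,
    Finsupp.single_apply]

theorem eq_sum_jackCoord {k : ℕ} {f : MvPolynomial (Fin (n + 1)) ℝ} (hf : f.IsHomogeneous k) :
    f = ∑ η ∈ compositions n k, jackCoord η f • nonsymJack η := by
  have h := mem_span_nonsymJack hf
  rw [← show (jackBasis : (Fin (n + 1) →₀ ℕ) → _) = nonsymJack from funext jackBasis_apply] at h
  have h2 := jackBasis.repr_support_subset_of_mem_span _ h
  conv_lhs => rw [← jackBasis.linearCombination_repr f, Finsupp.linearCombination_apply,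
    Finsupp.sum_of_support_subset _ (by exact_mod_cast h2) _ (by simp)]
  simp [jackCoord]

theorem jackCoord_cherednikOp (η : Fin (n + 1) →₀ ℕ) (i : Fin (n + 1))
    (f : MvPolynomial (Fin (n + 1)) ℝ) :
    jackCoord η (cherednikOp i f) = jackChar η i * jackCoord η f := by
  suffices h : jackCoord η ∘ₗ cherednikOp i = jackChar η i • jackCoord η from
    LinearMap.congr_fun h f
  refine jackBasis.ext fun ν => ?_
  simp only [jackBasis_apply, LinearMap.comp_apply, (isNonsymJack_nonsymJack ν).eigen, map_smul,
    LinearMap.smul_apply, jackCoord_nonsymJack, smul_eq_mul]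
  split_ifs with h
  · rw [h]
  · simp

theorem eq_smul_nonsymJack {η : Fin (n + 1) →₀ ℕ} {f : MvPolynomial (Fin (n + 1)) ℝ}
    (h : ∀ i, cherednikOp i f = jackChar η i • f) : f = jackCoord η f • nonsymJack η := by
  refine jackBasis.ext_elem fun ν => ?_
  change jackCoord ν f = jackCoord ν _
  rw [map_smul, jackCoord_nonsymJack]
  split_ifs with hν
  · rw [hν]; simp
  · obtain ⟨i, hi⟩ : ∃ i, jackChar ν i ≠ jackChar η i := by
      by_contra! hc
      exact hν (jackChar_injective (funext hc)).symm
    have h2 := jackCoord_cherednikOp ν i f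
    rw [h, map_smul, smul_eq_mul] at h2
    have h3 : (jackChar ν i - jackChar η i) * jackCoord ν f = 0 := by rw [sub_mul, h2, sub_self]
    simpa using (mul_eq_zero.1 h3).resolve_left (sub_ne_zero.2 hi)

theorem eq_smul_jackCoord {η : Fin (n + 1) →₀ ℕ} {φ : MvPolynomial (Fin (n + 1)) ℝ →ₗ[ℝ] ℝ}
    (h : ∀ i f, φ (cherednikOp i f) = jackChar η i * φ f) :
    φ = φ (nonsymJack η) • jackCoord η := by
  refine jackBasis.ext fun ν => ?_
  rw [jackBasis_apply, LinearMap.smul_apply, jackCoord_nonsymJack]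
  split_ifs with hν
  · rw [hν]; simp
  · obtain ⟨i, hi⟩ : ∃ i, jackChar ν i ≠ jackChar η i := by
      by_contra! hc
      exact hν (jackChar_injective (funext hc))
    have h2 := h i (nonsymJack ν)
    rw [(isNonsymJack_nonsymJack ν).eigen, map_smul, smul_eq_mul] at h2
    have h3 : (jackChar ν i - jackChar η i) * φ (nonsymJack ν) = 0 := by
      rw [sub_mul, h2, sub_self]
    simpa using (mul_eq_zero.1 h3).resolve_left (sub_ne_zero.2 hi)

theorem IsNonsymJack.exists_eq_smul {η : Fin (n + 1) →₀ ℕ}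
    {E : MvPolynomial (Fin (n + 1)) ℝ} (h : IsNonsymJack η E) :
    ∃ γ : ℝ, 0 < γ ∧ E = γ • nonsymJack η := by
  have h1 := eq_smul_nonsymJack h.eigen
  refine ⟨_, ?_, h1⟩
  have h2 := h.pos
  rw [h1, coeff_smul] at h2
  exact pos_of_mul_pos_left h2 (isNonsymJack_nonsymJack η).pos.le

/-- This is the intertwiner acting on coordinate functionals: the left side is a joint
eigenfunctional for the character of `swapExp k η`, hence a multiple of that coordinate. On
symmetric `f` it relates coordinates within one orbit by positive factors. -/
theorem exists_mul_jackCoord_eq {η : Fin (n + 1) →₀ ℕ} {k : Fin n}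
    (hk : η k.castSucc < η k.succ) : ∃ γ : ℝ, 0 < γ ∧
      ∀ f, jackCoord η (rename (adjSwap k) f) + swapCoeff k η * jackCoord η f =
        γ * jackCoord (swapExp k η) f := by
  set c := swapCoeff k η
  have hc : c * jackChar η k.succ = 1 + c * jackChar η k.castSucc := swapCoeff_mul hk
  have hc0 : 0 < c := swapCoeff_pos hk
  have hc1 : c < 1 := swapCoeff_lt_one hk
  let φ : MvPolynomial (Fin (n + 1)) ℝ →ₗ[ℝ] ℝ :=
    jackCoord η ∘ₗ (rename (adjSwap k)).toLinearMap + c • jackCoord η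
  have hφ : ∀ f, φ f = jackCoord η (rename (adjSwap k) f) + c * jackCoord η f := fun _ => rfl
  have h1 : ∀ i f, φ (cherednikOp i f) = jackChar (swapExp k η) i * φ f := by
    intro i f
    rw [hφ, hφ, jackChar_swapExp hk.ne, jackCoord_cherednikOp]
    rcases eq_or_ne i k.castSucc with rfl | h1
    · rw [rename_adjSwap_cherednikOp_castSucc, map_add, jackCoord_cherednikOp, adjSwap_castSucc]
      linear_combination -jackCoord η f * hc
    rcases eq_or_ne i k.succ with rfl | h2
    · rw [rename_adjSwap_cherednikOp_succ, map_sub, jackCoord_cherednikOp, adjSwap_succ]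
      linear_combination jackCoord η f * hc
    · rw [rename_adjSwap_cherednikOp_of_ne h1 h2, jackCoord_cherednikOp, adjSwap_of_ne h1 h2]
      ring
  have h2 := eq_smul_jackCoord h1
  refine ⟨φ (nonsymJack (swapExp k η)), ?_, fun f => ?_⟩
  · obtain ⟨γ, hγ, h3⟩ := ((isNonsymJack_nonsymJack η).swap hk).exists_eq_smul
    -- The sign of the factor is found by evaluating on the intertwined polynomial. Its
    -- `η`-coordinate vanishes, so `s_k E_η` has `η`-coordinate `-c`; the value `1 - c ^ 2` is
    -- positive because `0 < c < 1`.
    have h4 : φ (rename (adjSwap k) (nonsymJack η) + c • nonsymJack η) = 1 - c ^ 2 := by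
      have hne : swapExp k η ≠ η := fun h => by
        have := DFunLike.congr_fun h k.castSucc
        rw [swapExp_apply, adjSwap_castSucc] at this
        omega
      have h5 := congrArg (jackCoord η) h3
      rw [map_add, map_smul, map_smul, jackCoord_nonsymJack, jackCoord_nonsymJack, if_pos rfl,
        if_neg hne, smul_eq_mul, smul_eq_mul] at h5
      have h6 : jackCoord η (rename (adjSwap k) (nonsymJack η)) = -c := by linarith
      rw [map_add, map_smul, hφ, hφ, rename_adjSwap_rename_adjSwap, h6, jackCoord_nonsymJack,
        if_pos rfl, smul_eq_mul]
      ring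
    rw [h3, map_smul, smul_eq_mul] at h4
    have h5 : 0 < γ * φ (nonsymJack (swapExp k η)) := by rw [h4]; nlinarith
    exact pos_of_mul_pos_right h5 hγ.le
  · exact (hφ f).symm.trans (LinearMap.congr_fun h2 f)

theorem jackCoord_swapExp_pos_iff {η : Fin (n + 1) →₀ ℕ} {k : Fin n}
    (hk : η k.castSucc < η k.succ) {f : MvPolynomial (Fin (n + 1)) ℝ} (hf : f.IsSymmetric) :
    0 < jackCoord η f ↔ 0 < jackCoord (swapExp k η) f := by
  obtain ⟨γ, hγ, h⟩ := exists_mul_jackCoord_eq hk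
  have h1 := h f
  rw [hf (adjSwap k), ← one_add_mul] at h1
  have hc : 0 < 1 + swapCoeff k η := by linarith [swapCoeff_pos hk]
  rw [← mul_pos_iff_of_pos_left hc, h1, mul_pos_iff_of_pos_left hγ]

end jackBasis

/-! ### Symmetrization and symmetric Jack polynomials -/

section symmetrization

variable {n : ℕ}

/-- The sum of all permutations of a polynomial. -/
noncomputable def symmetrizer :
    MvPolynomial (Fin (n + 1)) ℝ →ₗ[ℝ] MvPolynomial (Fin (n + 1)) ℝ :=
  ∑ w : Equiv.Perm (Fin (n + 1)), (rename w).toLinearMap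

theorem symmetrizer_apply (f : MvPolynomial (Fin (n + 1)) ℝ) :
    symmetrizer f = ∑ w : Equiv.Perm (Fin (n + 1)), rename w f := by
  simp [symmetrizer]

theorem symmetrizer_rename (w : Equiv.Perm (Fin (n + 1))) (f : MvPolynomial (Fin (n + 1)) ℝ) :
    symmetrizer (rename w f) = symmetrizer f := by
  rw [symmetrizer_apply, symmetrizer_apply]
  refine Fintype.sum_equiv (Equiv.mulRight w) _ _ fun v => ?_
  rw [rename_rename]
  rfl

theorem symmetrizer_isSymmetric (f : MvPolynomial (Fin (n + 1)) ℝ) :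
    (symmetrizer f).IsSymmetric := by
  intro w
  rw [symmetrizer_apply, map_sum]
  refine Fintype.sum_equiv (Equiv.mulLeft w) _ _ fun v => ?_
  rw [rename_rename]
  rfl

theorem symmetrizer_of_isSymmetric {f : MvPolynomial (Fin (n + 1)) ℝ} (hf : f.IsSymmetric) :
    symmetrizer f = ((n + 1).factorial : ℝ) • f := by
  rw [symmetrizer_apply, Finset.sum_congr rfl fun w _ => hf w]
  simp [Finset.card_univ, Fintype.card_perm, Nat.cast_smul_eq_nsmul]

theorem coeff_symmetrizer (s : Fin (n + 1) →₀ ℕ) (f : MvPolynomial (Fin (n + 1)) ℝ) :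
    coeff s (symmetrizer f) = ∑ w : Equiv.Perm (Fin (n + 1)), coeff (s.mapDomain w) f := by
  rw [symmetrizer_apply, coeff_sum]
  refine Fintype.sum_equiv (Equiv.inv _) _ _ fun w => ?_
  have h : (s.mapDomain (w⁻¹ : Equiv.Perm (Fin (n + 1)))).mapDomain w = s := by
    rw [← Finsupp.mapDomain_comp, ← Equiv.Perm.coe_mul, mul_inv_cancel, Equiv.Perm.coe_one,
      Finsupp.mapDomain_id]
  have h1 := coeff_rename_perm w (s.mapDomain (w⁻¹ : Equiv.Perm (Fin (n + 1)))) f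
  rwa [h] at h1

/-- Sorting proceeds by swapping ascents, each of which lowers `weightedSize`. The symmetrizer
absorbs `s_k`, so an intertwiner becomes multiplication by `1 + c > 0`. -/
theorem exists_sortExp (η : Fin (n + 1) →₀ ℕ) : ∃ μ : Fin (n + 1) →₀ ℕ, Antitone μ ∧
    (∃ w : Equiv.Perm (Fin (n + 1)), (μ : Fin (n + 1) → ℕ) = η ∘ w) ∧
    (∃ r : ℝ, 0 < r ∧ symmetrizer (nonsymJack η) = r • symmetrizer (nonsymJack μ)) ∧
    ∀ f : MvPolynomial (Fin (n + 1)) ℝ, f.IsSymmetric →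
      (0 < jackCoord η f ↔ 0 < jackCoord μ f) := by
  induction hM : weightedSize η using Nat.strong_induction_on generalizing η with
  | _ M ih =>
  by_cases hk : ∃ k : Fin n, η k.castSucc < η k.succ
  · obtain ⟨k, hk⟩ := hk
    obtain ⟨μ, h1, ⟨w, hw⟩, ⟨r, hr, h2⟩, h3⟩ :=
      ih _ (hM ▸ weightedSize_swapExp_lt hk) (swapExp k η) rfl
    refine ⟨μ, h1, ⟨adjSwap k * w, ?_⟩, ?_, fun f hf =>
      (jackCoord_swapExp_pos_iff hk hf).trans (h3 f hf)⟩
    · rw [hw]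
      ext i
      simp [swapExp_apply]
    · obtain ⟨γ, hγ, h4⟩ := ((isNonsymJack_nonsymJack η).swap hk).exists_eq_smul
      have h5 := congrArg symmetrizer h4
      rw [map_add, map_smul, map_smul, symmetrizer_rename, h2] at h5
      have hc : 0 < 1 + swapCoeff k η := by linarith [swapCoeff_pos hk]
      have hsm : (1 + swapCoeff k η) • symmetrizer (nonsymJack η) =
          symmetrizer (nonsymJack η) + swapCoeff k η • symmetrizer (nonsymJack η) := by
        rw [add_smul, one_smul]
      refine ⟨(1 + swapCoeff k η)⁻¹ * (γ * r), by positivity, ?_⟩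
      rw [mul_smul, mul_smul, ← h5, ← hsm, inv_smul_smul₀ hc.ne']
  · push Not at hk
    exact ⟨η, Fin.antitone_iff_succ_le.2 hk, ⟨1, rfl⟩, ⟨1, one_pos, (one_smul _ _).symm⟩,
      fun _ _ => Iff.rfl⟩

/-- The exponent vector of a tuple. -/
noncomputable def toExp (ι : Fin (n + 1) → ℕ) : Fin (n + 1) →₀ ℕ :=
  Finsupp.equivFunOnFinite.symm ι

@[simp] theorem toExp_apply (ι : Fin (n + 1) → ℕ) (i : Fin (n + 1)) : toExp ι i = ι i := rfl

@[simp] theorem toExp_coe (η : Fin (n + 1) →₀ ℕ) : toExp (η : Fin (n + 1) → ℕ) = η := by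
  ext i; rfl

theorem degree_toExp (ι : Fin (n + 1) → ℕ) : (toExp ι).degree = ∑ i, ι i := by
  rw [Finsupp.degree_eq_sum]; rfl

/-- A positive multiple of the symmetric Jack polynomial of the partition `ι`. -/
noncomputable def symJack (ι : Fin (n + 1) → ℕ) : MvPolynomial (Fin (n + 1)) ℝ :=
  symmetrizer (nonsymJack (toExp ι))

/-- The weakly decreasing rearrangement of a composition. -/
noncomputable def sortComp (η : Fin (n + 1) →₀ ℕ) : Fin (n + 1) → ℕ :=
  ⇑(Classical.choose (exists_sortExp η))

theorem sortComp_antitone (η : Fin (n + 1) →₀ ℕ) : Antitone (sortComp η) :=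
  (Classical.choose_spec (exists_sortExp η)).1

theorem exists_sortComp_eq (η : Fin (n + 1) →₀ ℕ) :
    ∃ w : Equiv.Perm (Fin (n + 1)), sortComp η = η ∘ w :=
  (Classical.choose_spec (exists_sortExp η)).2.1

theorem exists_symmetrizer_nonsymJack_eq (η : Fin (n + 1) →₀ ℕ) :
    ∃ r : ℝ, 0 < r ∧ symmetrizer (nonsymJack η) = r • symJack (sortComp η) := by
  rw [symJack, sortComp, toExp_coe]
  exact (Classical.choose_spec (exists_sortExp η)).2.2.1

theorem jackCoord_pos_iff_sortComp (η : Fin (n + 1) →₀ ℕ) {f : MvPolynomial (Fin (n + 1)) ℝ}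
    (hf : f.IsSymmetric) : 0 < jackCoord η f ↔ 0 < jackCoord (toExp (sortComp η)) f := by
  rw [sortComp, toExp_coe]
  exact (Classical.choose_spec (exists_sortExp η)).2.2.2 f hf

theorem sortComp_mem_parts {k : ℕ} {η : Fin (n + 1) →₀ ℕ} (h : η.degree = k) :
    sortComp η ∈ parts (n + 1) k := by
  obtain ⟨w, hw⟩ := exists_sortComp_eq η
  refine mem_parts.2 ⟨?_, sortComp_antitone η⟩
  rw [hw, ← h, Finsupp.degree_eq_sum]
  exact Equiv.sum_comp w η

theorem sortComp_eq_of_perm {η : Fin (n + 1) →₀ ℕ} {ι : Fin (n + 1) → ℕ} (hι : Antitone ι)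
    (w : Equiv.Perm (Fin (n + 1))) (h : (η : Fin (n + 1) → ℕ) = ι ∘ w) : sortComp η = ι := by
  obtain ⟨v, hv⟩ := exists_sortComp_eq η
  have h1 : sortComp η = ι ∘ (w * v : Equiv.Perm (Fin (n + 1))) := by rw [hv, h]; rfl
  have h2 : ι = ι ∘ (1 : Equiv.Perm (Fin (n + 1))) := rfl
  rw [h1]
  conv_rhs => rw [h2]
  exact Tuple.unique_antitone (h1 ▸ sortComp_antitone η) (h2 ▸ hι)

theorem exists_sortComp_raiseExp_eq {k : ℕ} {ι : Fin (n + 1) → ℕ} (hι : ι ∈ parts (n + 1) (k + 1)) :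
    ∃ ν ∈ compositions n k, sortComp (raiseExp ν) = ι := by
  obtain ⟨hsum, hanti⟩ := mem_parts.1 hι
  have h0 : 0 < ι 0 := by
    by_contra h
    have : ∑ i, ι i = 0 := Finset.sum_eq_zero fun i _ => by
      have := hanti (Fin.zero_le i)
      omega
    omega
  let w : Equiv.Perm (Fin (n + 1)) := Equiv.swap 0 (Fin.last n)
  obtain ⟨ν, hν⟩ := exists_raiseExp_eq (η := toExp (ι ∘ w)) (by simpa [w] using h0)
  refine ⟨ν, ?_, ?_⟩
  · have h1 := degree_raiseExp ν
    rw [hν, degree_toExp] at h1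
    have h2 : ∑ i, (ι ∘ w) i = ∑ i, ι i := Equiv.sum_comp w ι
    rw [mem_compositions]
    omega
  · rw [hν]
    exact sortComp_eq_of_perm hanti w rfl

/-- The dominance order. -/
def DomLE (s t : Fin (n + 1) → ℕ) : Prop :=
  ∀ j, ∑ i ∈ Finset.Iic j, s i ≤ ∑ i ∈ Finset.Iic j, t i

theorem DomLE.trans {s t u : Fin (n + 1) → ℕ} (h : DomLE s t) (h' : DomLE t u) : DomLE s u :=
  fun j => (h j).trans (h' j)

/-- The sum of all partial sums. -/
def partialSums (s : Fin (n + 1) → ℕ) : ℕ := ∑ j, ∑ i ∈ Finset.Iic j, s i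

theorem DomLE.partialSums_le {s t : Fin (n + 1) → ℕ} (h : DomLE s t) :
    partialSums s ≤ partialSums t := Finset.sum_le_sum fun j _ => h j

theorem sum_Iic_succ {M : Type*} [AddCommMonoid M] (s : Fin (n + 1) → M) (j : Fin n) :
    ∑ i ∈ Finset.Iic j.succ, s i = ∑ i ∈ Finset.Iic j.castSucc, s i + s j.succ := by
  have h : Finset.Iic j.succ = insert j.succ (Finset.Iic j.castSucc) := by
    ext i; simp [Fin.le_def, Fin.ext_iff]; omega
  rw [h, Finset.sum_insert (by simp [Fin.le_def]), add_comm]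

theorem DomLE.eq_of_partialSums_le {s t : Fin (n + 1) → ℕ} (h : DomLE s t)
    (h' : partialSums t ≤ partialSums s) : s = t := by
  have h1 := (Finset.sum_eq_sum_iff_of_le fun j _ => h j).1 (h.partialSums_le.antisymm h')
  ext i
  induction i using Fin.cases with
  | zero =>
    have := h1 0 (Finset.mem_univ _)
    have h0 : (Finset.Iic 0 : Finset (Fin (n + 1))) = {0} := by ext; simp
    simpa [h0] using this
  | succ j =>
    have h2 := h1 j.succ (Finset.mem_univ _)
    have h3 := h1 j.castSucc (Finset.mem_univ _)
    rw [sum_Iic_succ, sum_Iic_succ] at h2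
    omega

/-- Level `a = 0` of the order ignores positions, so it survives symmetrization. Taking the
threshold `T = ι j` turns a bound on excesses into one on the `j`-th partial sum, as `ι` is
decreasing. -/
theorem domLE_of_coeff_symJack_ne_zero {ι : Fin (n + 1) → ℕ} (hι : Antitone ι)
    {s : Fin (n + 1) →₀ ℕ} (hs : coeff s (symJack ι) ≠ 0) : DomLE s ι := by
  rw [symJack, coeff_symmetrizer] at hs
  obtain ⟨w, -, hw⟩ := Finset.exists_ne_zero_of_sum_ne_zero hs
  have h1 := (isNonsymJack_nonsymJack _).triangular _ hw
  have h2 : ∀ T, ∑ i, (s i - T) ≤ ∑ i, (ι i - T) := fun T => by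
    have h3 := h1.2 T 0 (Nat.zero_le _)
    unfold excess at h3
    rw [← Equiv.sum_comp w] at h3
    simpa [mapDomain_perm_apply] using h3
  intro j
  calc ∑ i ∈ Finset.Iic j, s i ≤ ∑ i ∈ Finset.Iic j, ((s i - ι j) + ι j) :=
        Finset.sum_le_sum fun i _ => by omega
    _ = ∑ i ∈ Finset.Iic j, (s i - ι j) + ∑ i ∈ Finset.Iic j, ι j := Finset.sum_add_distrib
    _ ≤ ∑ i, (s i - ι j) + ∑ i ∈ Finset.Iic j, ι j :=
        Nat.add_le_add_right (Finset.sum_le_sum_of_subset (Finset.subset_univ _)) _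
    _ ≤ ∑ i, (ι i - ι j) + ∑ i ∈ Finset.Iic j, ι j := Nat.add_le_add_right (h2 _) _
    _ = ∑ i ∈ Finset.Iic j, (ι i - ι j) + ∑ i ∈ Finset.Iic j, ι j := by
        congr 1
        refine (Finset.sum_subset (Finset.subset_univ _) fun i _ hi => ?_).symm
        have : j ≤ i := by simp at hi; exact hi.le
        have := hι this
        omega
    _ = ∑ i ∈ Finset.Iic j, ι i := by
        rw [← Finset.sum_add_distrib]
        refine Finset.sum_congr rfl fun i hi => ?_
        have := hι (Finset.mem_Iic.1 hi)
        omega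

theorem coeff_symJack_nonneg (ι : Fin (n + 1) → ℕ) (s : Fin (n + 1) →₀ ℕ) :
    0 ≤ coeff s (symJack ι) := by
  rw [symJack, coeff_symmetrizer]
  exact Finset.sum_nonneg fun w _ => (isNonsymJack_nonsymJack _).nonneg _

theorem coeff_symJack_pos (ι : Fin (n + 1) → ℕ) : 0 < coeff (toExp ι) (symJack ι) := by
  rw [symJack, coeff_symmetrizer]
  refine Finset.sum_pos' (fun w _ => (isNonsymJack_nonsymJack _).nonneg _)
    ⟨1, Finset.mem_univ _, ?_⟩
  rw [Equiv.Perm.coe_one, Finsupp.mapDomain_id]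
  exact (isNonsymJack_nonsymJack _).pos

theorem symJack_isHomogeneous {k : ℕ} {ι : Fin (n + 1) → ℕ} (h : ι ∈ parts (n + 1) k) :
    (symJack ι).IsHomogeneous k := by
  rw [symJack, symmetrizer_apply]
  refine IsHomogeneous.sum _ _ _ fun w _ => IsHomogeneous.rename_isHomogeneous ?_
  have := (isNonsymJack_nonsymJack (toExp ι)).isHomogeneous
  rwa [degree_toExp, (mem_parts.1 h).1] at this

/-- A combination of symmetric Jack polynomials has a leading monomial above each of its terms. -/
theorem exists_coeff_ne_zero_of_sum {K : Type*} [Field K] [Algebra ℝ K] {k : ℕ}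
    (a : (Fin (n + 1) → ℕ) → K) {μ : Fin (n + 1) → ℕ} (hμ : μ ∈ parts (n + 1) k) (ha : a μ ≠ 0) :
    ∃ ι ∈ parts (n + 1) k, a ι ≠ 0 ∧ DomLE μ ι ∧
      coeff (toExp ι) (∑ ν ∈ parts (n + 1) k, a ν • map (algebraMap ℝ K) (symJack ν)) ≠ 0 := by
  classical
  have hne : ((parts (n + 1) k).filter fun ι => a ι ≠ 0 ∧ DomLE μ ι).Nonempty :=
    ⟨μ, Finset.mem_filter.2 ⟨hμ, ha, fun _ => le_rfl⟩⟩
  obtain ⟨ι, hι, hmax⟩ := Finset.exists_max_image _ partialSums hne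
  obtain ⟨h1, h2, h3⟩ := Finset.mem_filter.1 hι
  refine ⟨ι, h1, h2, h3, ?_⟩
  rw [coeff_sum, Finset.sum_eq_single ι]
  · rw [coeff_smul, coeff_map, smul_eq_mul]
    exact mul_ne_zero h2 ((map_ne_zero _).2 (coeff_symJack_pos ι).ne')
  · intro ν hν hne
    rw [coeff_smul, coeff_map, smul_eq_mul]
    by_contra hc
    have h4 := left_ne_zero_of_mul hc
    have h5 : DomLE ι ν := domLE_of_coeff_symJack_ne_zero (mem_parts.1 hν).2
      ((map_ne_zero _).1 (right_ne_zero_of_mul hc))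
    exact hne (h5.eq_of_partialSums_le
      (hmax ν (Finset.mem_filter.2 ⟨hν, h4, h3.trans h5⟩))).symm
  · exact fun h => absurd h1 h

theorem symJack_coeff_unique {K : Type*} [Field K] [Algebra ℝ K] {k : ℕ}
    {a b : (Fin (n + 1) → ℕ) → K}
    (h : ∑ ν ∈ parts (n + 1) k, a ν • map (algebraMap ℝ K) (symJack ν) =
      ∑ ν ∈ parts (n + 1) k, b ν • map (algebraMap ℝ K) (symJack ν)) :
    ∀ ν ∈ parts (n + 1) k, a ν = b ν := by
  intro ν hν
  by_contra hc
  obtain ⟨ι, -, -, -, h1⟩ := exists_coeff_ne_zero_of_sum (fun ν => a ν - b ν) hν (sub_ne_zero.2 hc)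
  apply h1
  simp only [sub_smul, Finset.sum_sub_distrib]
  rw [h, sub_self, coeff_zero]

/-- Symmetrizing a combination groups its terms by sorted composition, with positive weights. The
map `φ` allows for both the identity and `raiseExp`. -/
theorem exists_symmetrizer_eq_sum {k : ℕ} (t : (Fin (n + 1) →₀ ℕ) → ℝ)
    (φ : (Fin (n + 1) →₀ ℕ) → (Fin (n + 1) →₀ ℕ)) {l : ℕ}
    (hφ : ∀ ν ∈ compositions n k, (φ ν).degree = l) :
    ∃ r : (Fin (n + 1) →₀ ℕ) → ℝ, (∀ ν, 0 < r ν) ∧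
      symmetrizer (∑ ν ∈ compositions n k, t ν • nonsymJack (φ ν)) =
      ∑ ι ∈ parts (n + 1) l,
        (∑ ν ∈ (compositions n k).filter (fun ν => sortComp (φ ν) = ι), t ν * r ν) • symJack ι := by
  choose r hr h using fun ν : Fin (n + 1) →₀ ℕ => exists_symmetrizer_nonsymJack_eq (φ ν)
  refine ⟨r, hr, ?_⟩
  rw [map_sum, ← Finset.sum_fiberwise_of_maps_to (g := fun ν => sortComp (φ ν))
    fun ν hν => sortComp_mem_parts (hφ ν hν)]
  refine Finset.sum_congr rfl fun ι _ => ?_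
  rw [Finset.sum_smul]
  refine Finset.sum_congr rfl fun ν hν => ?_
  rw [map_smul, h, (Finset.mem_filter.1 hν).2, smul_smul]

theorem exists_eq_sum_symJack {k : ℕ} {f : MvPolynomial (Fin (n + 1)) ℝ} (hs : f.IsSymmetric)
    (hf : f.IsHomogeneous k) :
    ∃ a : (Fin (n + 1) → ℕ) → ℝ, f = ∑ ι ∈ parts (n + 1) k, a ι • symJack ι := by
  obtain ⟨r, -, h⟩ := exists_symmetrizer_eq_sum (fun ν => jackCoord ν f) id
    (k := k) (l := k) (fun ν hν => mem_compositions.1 hν)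
  simp only [id] at h
  rw [← eq_sum_jackCoord hf, symmetrizer_of_isSymmetric hs] at h
  have h0 : ((n + 1).factorial : ℝ) ≠ 0 := by positivity
  rw [← eq_inv_smul_iff₀ h0, Finset.smul_sum] at h
  simp only [smul_smul] at h
  exact ⟨_, h⟩

end symmetrization

/-! ### Positivity of the expansion of powers of the sum of the variables -/

section powers

variable {n : ℕ}

theorem isSymmetric_sum_X_pow (k : ℕ) :
    ((∑ i, X i : MvPolynomial (Fin (n + 1)) ℝ) ^ k).IsSymmetric := fun w => by
  rw [map_pow, map_sum]
  simp only [rename_X]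
  rw [Equiv.sum_comp w fun i => (X i : MvPolynomial (Fin (n + 1)) ℝ)]

theorem isHomogeneous_sum_X_pow (k : ℕ) :
    ((∑ i, X i : MvPolynomial (Fin (n + 1)) ℝ) ^ k).IsHomogeneous k := by
  simpa using (IsHomogeneous.sum Finset.univ _ 1 fun i _ => isHomogeneous_X ℝ i).pow k

theorem toExp_mem_compositions {k : ℕ} {ι : Fin (n + 1) → ℕ} (h : ι ∈ parts (n + 1) k) :
    toExp ι ∈ compositions n k := by
  rw [mem_compositions, degree_toExp, (mem_parts.1 h).1]

/-- For symmetric `f` the raising operator is multiplication by `x_n`, and all the `x_i f` have the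
same symmetrization. -/
theorem symmetrizer_sum_X_mul {f : MvPolynomial (Fin (n + 1)) ℝ} (hf : f.IsSymmetric) :
    symmetrizer ((∑ i, X i) * f) = ((n : ℝ) + 1) • symmetrizer (raiseOp f) := by
  rw [Finset.sum_mul, map_sum, Finset.sum_congr rfl (g := fun _ => symmetrizer (raiseOp f))]
  · simp [← Nat.cast_smul_eq_nsmul ℝ]
  · intro i _
    rw [raiseOp_apply, hf, ← symmetrizer_rename (Equiv.swap i (Fin.last n)), map_mul, hf, rename_X,
      Equiv.swap_apply_left]

/-- Two expansions of the symmetrized power are compared: through raising, whose coefficients are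
positive by induction and meet every partition of `k + 1`, and through its own coordinates.
Comparison shows that each orbit contains a positive coordinate, and by symmetry one positive
coordinate makes its whole orbit positive. -/
theorem jackCoord_sum_X_pow_pos (k : ℕ) : ∀ η ∈ compositions n k,
    0 < jackCoord η ((∑ i, X i : MvPolynomial (Fin (n + 1)) ℝ) ^ k) := by
  induction k with
  | zero =>
    intro η hη
    rw [mem_compositions, Finsupp.degree_eq_zero_iff] at hη
    obtain ⟨γ, hγ, h⟩ := (isNonsymJack_one (n := n)).exists_eq_smul
    rw [hη, pow_zero, h, map_smul, jackCoord_nonsymJack, if_pos rfl]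
    simpa using hγ
  | succ k ih =>
    set f : MvPolynomial (Fin (n + 1)) ℝ := (∑ i, X i) ^ k
    have hf : f.IsSymmetric := isSymmetric_sum_X_pow k
    choose γ hγ hraise using
      fun ν : Fin (n + 1) →₀ ℕ => (isNonsymJack_nonsymJack ν).raise.exists_eq_smul
    have h1 : raiseOp f = ∑ ν ∈ compositions n k,
        (jackCoord ν f * γ ν) • nonsymJack (raiseExp ν) := by
      refine (congrArg raiseOp (eq_sum_jackCoord (isHomogeneous_sum_X_pow k))).trans ?_
      rw [map_sum]
      exact Finset.sum_congr rfl fun ν _ => by rw [map_smul, hraise, smul_smul]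
    obtain ⟨r, hr, h2⟩ := exists_symmetrizer_eq_sum (fun ν => jackCoord ν f * γ ν) raiseExp
      (k := k) (l := k + 1) fun ν hν => by rw [degree_raiseExp, mem_compositions.1 hν]
    rw [← h1] at h2
    set g : MvPolynomial (Fin (n + 1)) ℝ := (∑ i, X i) ^ (k + 1)
    have hg : g.IsSymmetric := isSymmetric_sum_X_pow (k + 1)
    obtain ⟨q, hq, h3⟩ := exists_symmetrizer_eq_sum (fun ν => jackCoord ν g) id
      (k := k + 1) (l := k + 1) fun ν hν => mem_compositions.1 hν
    simp only [id] at h3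
    have hgf : (∑ i, X i) * f = g := (pow_succ' _ k).symm
    replace h3 := ((congrArg symmetrizer hgf).trans
      (congrArg symmetrizer (eq_sum_jackCoord (isHomogeneous_sum_X_pow (k + 1))))).trans h3
    rw [symmetrizer_sum_X_mul hf, h2, Finset.smul_sum] at h3
    simp only [smul_smul] at h3
    intro η hη
    have hι := sortComp_mem_parts (mem_compositions.1 hη)
    have h4 := symJack_coeff_unique (K := ℝ) (k := k + 1)
      (by simpa only [Algebra.algebraMap_self, map_id] using h3) _ hι
    have h5 : 0 < ∑ ν ∈ (compositions n k).filter (fun ν => sortComp (raiseExp ν) = sortComp η),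
        jackCoord ν f * γ ν * r ν := by
      obtain ⟨ν, hν, hνη⟩ := exists_sortComp_raiseExp_eq hι
      refine Finset.sum_pos (fun ν hν => ?_) ⟨ν, Finset.mem_filter.2 ⟨hν, hνη⟩⟩
      exact mul_pos (mul_pos (ih ν (Finset.mem_filter.1 hν).1) (hγ ν)) (hr ν)
    have h6 : 0 < ∑ ν ∈ (compositions n (k + 1)).filter (fun ν => sortComp ν = sortComp η),
        jackCoord ν g * q ν := by
      rw [← h4]
      positivity
    obtain ⟨ν, hν, h7⟩ := Finset.exists_lt_of_sum_lt (s := (compositions n (k + 1)).filter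
      (fun ν => sortComp ν = sortComp η)) (f := fun _ => (0 : ℝ)) (by simpa using h6)
    have h8 : 0 < jackCoord ν g := pos_of_mul_pos_left h7 (hq ν).le
    rw [jackCoord_pos_iff_sortComp ν hg, (Finset.mem_filter.1 hν).2] at h8
    exact (jackCoord_pos_iff_sortComp η hg).2 h8

theorem exists_sum_X_pow_eq_sum_symJack (n k : ℕ) : ∃ c : (Fin (n + 1) → ℕ) → ℝ,
    (∀ ι ∈ parts (n + 1) k, 0 < c ι) ∧
      (∑ i, X i : MvPolynomial (Fin (n + 1)) ℝ) ^ k = ∑ ι ∈ parts (n + 1) k, c ι • symJack ι := by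
  set g : MvPolynomial (Fin (n + 1)) ℝ := (∑ i, X i) ^ k
  obtain ⟨r, hr, h⟩ := exists_symmetrizer_eq_sum (fun ν => jackCoord ν g) id
    (k := k) (l := k) fun ν hν => mem_compositions.1 hν
  simp only [id] at h
  have h0 : (0 : ℝ) < ((n + 1).factorial : ℝ) := by positivity
  rw [← eq_sum_jackCoord (isHomogeneous_sum_X_pow k : g.IsHomogeneous k),
    symmetrizer_of_isSymmetric (isSymmetric_sum_X_pow k), ← eq_inv_smul_iff₀ h0.ne',
    Finset.smul_sum] at h
  simp only [smul_smul] at h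
  refine ⟨_, fun ι hι => ?_, h⟩
  refine mul_pos (inv_pos.2 h0) (Finset.sum_pos (fun ν hν => ?_) ⟨toExp ι, ?_⟩)
  · exact mul_pos (jackCoord_sum_X_pow_pos k ν (Finset.mem_filter.1 hν).1) (hr ν)
  · exact Finset.mem_filter.2 ⟨toExp_mem_compositions hι,
      sortComp_eq_of_perm (mem_parts.1 hι).2 1 rfl⟩

end powers

/-! ### The sum of squares of Heckman operators on symmetric Jack polynomials -/

section eigenvalue

variable {n : ℕ}

theorem jackChar_toExp {ι : Fin (n + 1) → ℕ} (h : Antitone ι) (i : Fin (n + 1)) :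
    jackChar (toExp ι) i = 2 * ι i - (i : ℕ) := by
  have h1 : (Finset.univ.filter fun j => Precedes (toExp ι) j i) = Finset.Iio i := by
    ext j
    rw [Finset.mem_filter, Finset.mem_Iio, Precedes, toExp_apply, toExp_apply]
    simp only [Finset.mem_univ, true_and]
    constructor
    · rintro (h2 | h2)
      · by_contra h3
        exact absurd (h (not_lt.1 h3)) (not_le.2 h2)
      · exact h2.2
    · intro h2
      have := h h2.le
      omega
  rw [jackChar, compRank, h1, Fin.card_Iio, toExp_apply]

/-- Symmetrization turns each transposition in the Cherednik operator into the identity; the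
resulting `n - i` cancels against `-n` and the rank `i`. -/
theorem symmetrizer_heckmanOp (ι : Fin (n + 1) → ℕ) (hι : Antitone ι) (i : Fin (n + 1)) :
    symmetrizer (heckmanOp i (nonsymJack (toExp ι))) = (2 * ι i : ℝ) • symJack ι := by
  have h := (isNonsymJack_nonsymJack (toExp ι)).eigen i
  rw [cherednikOp_apply, jackChar_toExp hι] at h
  have h1 := congrArg symmetrizer h
  rw [map_sub, map_add, map_sum, Finset.sum_congr rfl fun j _ => symmetrizer_rename _ _,
    Finset.sum_const, Fin.card_Ioi, map_smul, map_smul, ← Nat.cast_smul_eq_nsmul ℝ] at h1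
  rw [show n + 1 - 1 - (i : ℕ) = n - i by omega, Nat.cast_sub (by omega)] at h1
  rw [symJack]
  linear_combination (norm := module) h1

theorem symmetrizer_heckmanOp_heckmanOp (ι : Fin (n + 1) → ℕ) (hι : Antitone ι)
    (i : Fin (n + 1)) :
    symmetrizer (heckmanOp i (heckmanOp i (nonsymJack (toExp ι)))) =
      ((2 * ι i - (i : ℕ) + n) * (2 * ι i) - ∑ j ∈ Finset.Ioi i, (2 * ι j : ℝ)) • symJack ι := by
  have h := (isNonsymJack_nonsymJack (toExp ι)).eigen i
  rw [cherednikOp_apply, jackChar_toExp hι] at h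
  have h1 := congrArg (fun f => symmetrizer (heckmanOp i f)) h
  -- By equivariance `s_{ij}` converts the operator at `i` into the one at `j`, which brings in the
  -- entry `ι j`.
  have h2 : ∀ j ∈ Finset.Ioi i, symmetrizer (heckmanOp i
      (rename (Equiv.swap i j) (nonsymJack (toExp ι)))) = (2 * ι j : ℝ) • symJack ι :=
    fun j _ => by
      rw [← symmetrizer_heckmanOp ι hι j, ← symmetrizer_rename (Equiv.swap i j)
        (heckmanOp j _), rename_heckmanOp, Equiv.swap_apply_right]
  simp only [map_sub, map_add, map_sum, map_smul] at h1
  rw [Finset.sum_congr rfl h2, ← Finset.sum_smul, symmetrizer_heckmanOp ι hι i] at h1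
  linear_combination (norm := module) h1

/-- The eigenvalue of `∑ i, heckmanOp i ∘ heckmanOp i` on `symJack ι`. -/
noncomputable def squareEigenvalue (ι : Fin (n + 1) → ℕ) : ℝ :=
  ∑ i, ((2 * ι i - (i : ℕ) + n) * (2 * ι i) - ∑ j ∈ Finset.Ioi i, (2 * ι j : ℝ))

theorem sum_heckmanOp_symmetrizer (f : MvPolynomial (Fin (n + 1)) ℝ) :
    ∑ i, heckmanOp i (heckmanOp i (symmetrizer f)) =
      symmetrizer (∑ i, heckmanOp i (heckmanOp i f)) := by
  simp only [symmetrizer_apply, map_sum]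
  rw [Finset.sum_comm]
  conv_rhs => rw [Finset.sum_comm]
  refine Finset.sum_congr rfl fun w _ => ?_
  rw [← Equiv.sum_comp w]
  refine Finset.sum_congr rfl fun i _ => ?_
  rw [rename_heckmanOp, rename_heckmanOp]

theorem sum_heckmanOp_symJack {ι : Fin (n + 1) → ℕ} (hι : Antitone ι) :
    ∑ i, heckmanOp i (heckmanOp i (symJack ι)) = squareEigenvalue ι • symJack ι := by
  conv_lhs => rw [symJack, sum_heckmanOp_symmetrizer, map_sum]
  rw [Finset.sum_congr rfl fun i _ => symmetrizer_heckmanOp_heckmanOp ι hι i, ← Finset.sum_smul,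
    squareEigenvalue]

theorem sum_Ioi_eq (s : Fin (n + 1) → ℕ) (i : Fin (n + 1)) :
    ∑ j ∈ Finset.Ioi i, (s j : ℝ) = ∑ j, (s j : ℝ) - ∑ j ∈ Finset.Iic i, (s j : ℝ) := by
  rw [eq_sub_iff_add_eq', ← Finset.sum_union]
  · congr 1
    ext j; simp [le_or_gt]
  · rw [Finset.disjoint_left]
    intro j; simp

theorem sum_sum_Iic (s : Fin (n + 1) → ℕ) :
    ∑ j : Fin (n + 1), ∑ i ∈ Finset.Iic j, (s i : ℝ) =
      ∑ i : Fin (n + 1), ((n : ℝ) + 1 - (i : ℕ)) * s i := by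
  rw [Finset.sum_comm' (t' := Finset.univ) (s' := fun i => Finset.Ici i) (by simp)]
  refine Finset.sum_congr rfl fun i _ => ?_
  rw [Finset.sum_const, Fin.card_Ici, nsmul_eq_mul, Nat.cast_sub (by omega)]
  push_cast
  ring

theorem squareEigenvalue_eq {k : ℕ} {ι : Fin (n + 1) → ℕ} (h : ∑ i, ι i = k) :
    squareEigenvalue ι = 4 * ∑ i, (ι i : ℝ) ^ 2 + 4 * (partialSums ι : ℝ) - (2 * n + 4) * k := by
  have hk : ∑ i, (ι i : ℝ) = k := by exact_mod_cast h
  have h1 : ((partialSums ι : ℕ) : ℝ) = ∑ j, ∑ i ∈ Finset.Iic j, (ι i : ℝ) := by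
    simp [partialSums]
  have h2 := sum_sum_Iic ι
  have h3 : squareEigenvalue ι = ∑ i, (4 * (ι i : ℝ) ^ 2 + 2 * (((n : ℝ) + 1 - (i : ℕ)) * ι i)
      - 2 * ι i - 2 * k + 2 * ∑ j ∈ Finset.Iic i, (ι j : ℝ)) := by
    refine Finset.sum_congr rfl fun i _ => ?_
    rw [← Finset.mul_sum, sum_Ioi_eq, hk]
    ring
  rw [h3, Finset.sum_add_distrib, Finset.sum_sub_distrib, Finset.sum_sub_distrib,
    Finset.sum_add_distrib, ← Finset.mul_sum, ← Finset.mul_sum, ← Finset.mul_sum, ← Finset.mul_sum,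
    ← Finset.mul_sum, ← h2, hk, h1]
  simp
  ring

/-- Summation by parts against the decreasing `s` gives `∑ s_i (t_i - s_i) ≥ 0`, and `t_i ^ 2 - s_i
^ 2 ≥ 2 s_i (t_i - s_i)`. -/
theorem sum_sq_le_of_domLE {s t : Fin (n + 1) → ℕ} (hs : Antitone s) (h : DomLE s t) :
    ∑ i, (s i : ℝ) ^ 2 ≤ ∑ i, (t i : ℝ) ^ 2 := by
  have h0 : ∀ j, 0 ≤ ∑ i ∈ Finset.Iic j, ((t i : ℝ) - s i) := fun j => by
    rw [Finset.sum_sub_distrib, sub_nonneg]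
    exact_mod_cast h j
  have h1 : ∀ j, (s j : ℝ) * ∑ i ∈ Finset.Iic j, ((t i : ℝ) - s i) ≤
      ∑ i ∈ Finset.Iic j, (s i : ℝ) * ((t i : ℝ) - s i) := by
    intro j
    induction j using Fin.induction with
    | zero =>
      have h0 : (Finset.Iic 0 : Finset (Fin (n + 1))) = {0} := by ext; simp
      simp [h0]
    | succ j ih =>
      rw [sum_Iic_succ, sum_Iic_succ, mul_add]
      have h2 : (s j.succ : ℝ) ≤ s j.castSucc := by exact_mod_cast hs j.castSucc_lt_succ.le
      have h3 := mul_le_mul_of_nonneg_right h2 (h0 j.castSucc)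
      linarith
  have h2 := h1 (Fin.last n)
  have h3 := mul_nonneg (Nat.cast_nonneg (α := ℝ) (s (Fin.last n))) (h0 (Fin.last n))
  have hu : (Finset.Iic (Fin.last n)) = Finset.univ := by ext i; simp [Fin.le_last]
  rw [hu] at h2 h3
  have h4 : ∑ i, (2 * ((s i : ℝ) * ((t i : ℝ) - s i))) ≤ ∑ i, ((t i : ℝ) ^ 2 - (s i : ℝ) ^ 2) :=
    Finset.sum_le_sum fun i _ => by nlinarith [sq_nonneg ((t i : ℝ) - s i)]
  rw [← Finset.mul_sum, Finset.sum_sub_distrib] at h4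
  linarith

theorem squareEigenvalue_lt {k : ℕ} {s t : Fin (n + 1) → ℕ} (hs : s ∈ parts (n + 1) k)
    (ht : t ∈ parts (n + 1) k) (h : DomLE s t) (hne : s ≠ t) :
    squareEigenvalue s < squareEigenvalue t := by
  rw [squareEigenvalue_eq (mem_parts.1 hs).1, squareEigenvalue_eq (mem_parts.1 ht).1]
  have h1 := sum_sq_le_of_domLE (mem_parts.1 hs).2 h
  have h2 : partialSums s < partialSums t := by
    by_contra hc
    exact hne (h.eq_of_partialSums_le (not_lt.1 hc))
  have h3 : (partialSums s : ℝ) < partialSums t := by exact_mod_cast h2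
  linarith

end eigenvalue

/-! ### The Laplace–Beltrami operator as a sum of squares -/

section laplace

variable {n : ℕ}

theorem divDiff_X_mul_pderiv_spec {P : MvPolynomial (Fin (n + 1)) ℝ} (hP : P.IsSymmetric)
    (i j : Fin (n + 1)) :
    (X i - X j) * divDiff i j (X i * pderiv i P) = X i * pderiv i P - X j * pderiv j P := by
  rw [divDiff_spec, map_mul, rename_X, ← pderiv_rename (Equiv.injective _), hP,
    Equiv.swap_apply_left]

theorem sum_heckmanOp_of_isSymmetric {P : MvPolynomial (Fin (n + 1)) ℝ} (hP : P.IsSymmetric) :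
    ∑ i, heckmanOp i (heckmanOp i P) = 4 * ∑ i, X i ^ 2 * pderiv i (pderiv i P) +
      4 * ∑ i, X i * pderiv i P +
      2 * ∑ i, ∑ j ∈ Finset.univ.erase i, X i * divDiff i j (X i * pderiv i P) := by
  rw [Finset.mul_sum, Finset.mul_sum, Finset.mul_sum, ← Finset.sum_add_distrib,
    ← Finset.sum_add_distrib]
  refine Finset.sum_congr rfl fun i _ => ?_
  rw [heckmanOp_of_isSymmetric i hP, show (2 : MvPolynomial (Fin (n + 1)) ℝ) * (X i * pderiv i P) =
    (2 : ℝ) • (X i * pderiv i P) by rw [smul_eq_C_mul, map_ofNat], map_smul, heckmanOp_apply,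
    Derivation.leibniz, pderiv_X_self, smul_eq_C_mul, map_ofNat]
  simp only [smul_eq_mul]
  ring

theorem deltaAt_map {k : ℕ} {κ : ℝ} {P : MvPolynomial (Fin (n + 1)) ℝ} (hP : P.IsSymmetric)
    (hk : P.IsHomogeneous k) (h : ∑ i, heckmanOp i (heckmanOp i P) = κ • P)
    {α : Fin (n + 1) → ℂ} (hα : Function.Injective α) :
    deltaAt (map (algebraMap ℝ ℂ) P) α =
      ((κ - (4 - 2 * n) * k) / 4 : ℝ) * eval α (map (algebraMap ℝ ℂ) P) := by
  rw [sum_heckmanOp_of_isSymmetric hP] at h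
  set Q := map (algebraMap ℝ ℂ) P with hQ
  set D : Fin (n + 1) → ℂ := fun i => eval α (pderiv i Q) with hD
  have hpd : ∀ i (p : MvPolynomial (Fin (n + 1)) ℝ),
      map (algebraMap ℝ ℂ) (pderiv i p) = pderiv i (map (algebraMap ℝ ℂ) p) :=
    fun i p => (pderiv_map).symm
  have hE : ∑ i, α i * D i = k * eval α Q := by
    have h1 := congrArg (eval α) (hk.map (algebraMap ℝ ℂ)).sum_X_mul_pderiv
    simpa only [map_sum, map_mul, eval_X, map_nsmul, nsmul_eq_mul, map_natCast] using h1
  set g : Fin (n + 1) → Fin (n + 1) → ℂ := fun i j =>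
    eval α (map (algebraMap ℝ ℂ) (divDiff i j (X i * pderiv i P))) with hg
  have hgs : ∀ i j, (α i - α j) * g i j = α i * D i - α j * D j := fun i j => by
    have h1 := congrArg (fun p => eval α (map (algebraMap ℝ ℂ) p))
      (divDiff_X_mul_pderiv_spec hP i j)
    simpa only [map_mul, map_sub, map_X, eval_X, hpd] using h1
  have h2 := congrArg (fun p => eval α (map (algebraMap ℝ ℂ) p)) h
  simp only [map_add, map_mul, map_sum, map_ofNat, map_X, map_pow, eval_X, hpd, smul_eq_C_mul,
    map_C, eval_C] at h2
  set A := ∑ i, ∑ j ∈ Finset.univ.erase i, α i ^ 2 / (α i - α j) * D i with hA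
  -- Exchanging the indices in the second half of the divided difference and using `α_i α_j / (α_j -
  -- α_i) = α_i - α_i ^ 2 / (α_i - α_j)` gives a second copy of `A`, less `n` times the Euler
  -- operator.
  have h3 : ∑ i, ∑ j ∈ Finset.univ.erase i, α i * g i j = 2 * A - n * (k * eval α Q) := by
    have hB : ∑ i, ∑ j ∈ Finset.univ.erase i, α i * α j / (α i - α j) * D j =
        ∑ i, ∑ j ∈ Finset.univ.erase i, α j * α i / (α j - α i) * D i :=
      Finset.sum_comm' (by simp [eq_comm])
    have h4 : ∑ i, ∑ j ∈ Finset.univ.erase i, α i * g i j =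
        A - ∑ i, ∑ j ∈ Finset.univ.erase i, α i * α j / (α i - α j) * D j := by
      rw [hA, ← Finset.sum_sub_distrib]
      refine Finset.sum_congr rfl fun i _ => ?_
      rw [← Finset.sum_sub_distrib]
      refine Finset.sum_congr rfl fun j hj => ?_
      have hne : α i - α j ≠ 0 := sub_ne_zero.2 (hα.ne (Finset.ne_of_mem_erase hj).symm)
      have h5 : g i j = (α i * D i - α j * D j) / (α i - α j) := by
        rw [← hgs, mul_div_cancel_left₀ _ hne]
      rw [h5]
      field_simp
    have h5 : ∑ i, ∑ j ∈ Finset.univ.erase i, α j * α i / (α j - α i) * D i =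
        n * (k * eval α Q) - A := by
      rw [← hE, hA, Finset.mul_sum, ← Finset.sum_sub_distrib]
      refine Finset.sum_congr rfl fun i _ => ?_
      have h6 : (n : ℂ) * (α i * D i) = ∑ j ∈ Finset.univ.erase i, α i * D i := by
        simp [Finset.card_erase_of_mem]
      rw [h6, ← Finset.sum_sub_distrib]
      refine Finset.sum_congr rfl fun j hj => ?_
      have hne : α i - α j ≠ 0 := sub_ne_zero.2 (hα.ne (Finset.ne_of_mem_erase hj).symm)
      have hne' : α j - α i ≠ 0 := sub_ne_zero.2 (hα.ne (Finset.ne_of_mem_erase hj))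
      field_simp
      ring
    rw [h4, hB, h5]
    ring
  have h2' : 4 * (∑ i, α i ^ 2 * eval α (pderiv i (pderiv i Q))) + 4 * ∑ i, α i * D i +
      2 * ∑ i, ∑ j ∈ Finset.univ.erase i, α i * g i j = (algebraMap ℝ ℂ κ) * eval α Q := h2
  rw [h3, hE] at h2'
  have h6 : deltaAt Q α = (∑ i, α i ^ 2 * eval α (pderiv i (pderiv i Q))) + A := rfl
  rw [h6]
  push_cast
  have h7 : (algebraMap ℝ ℂ κ) = (κ : ℂ) := rfl
  rw [h7] at h2'
  linear_combination h2' / 4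

end laplace

/-! ### Existence, uniqueness and positivity of zonal polynomials -/

section zonal

variable {n : ℕ}

/-- Multiplying by the product of all `x_i - x_j` gives a polynomial that vanishes at every point;
this product is nonzero and can be cancelled. -/
theorem eq_zero_of_eval_injective {d : ℕ} {p : MvPolynomial (Fin d) ℂ}
    (h : ∀ α : Fin d → ℂ, Function.Injective α → eval α p = 0) : p = 0 := by
  have h1 : p * ∏ x ∈ (Finset.univ : Finset (Fin d)).offDiag, (X x.1 - X x.2) = 0 := by
    refine MvPolynomial.funext fun α => ?_
    rw [map_mul, map_zero]
    by_cases hα : Function.Injective α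
    · rw [h α hα, zero_mul]
    · obtain ⟨i, j, hij, hne⟩ : ∃ i j, α i = α j ∧ i ≠ j := by
        simpa [Function.Injective] using hα
      rw [map_prod, Finset.prod_eq_zero (i := (i, j)), mul_zero]
      · simpa using hne
      · simp [hij]
  refine (mul_eq_zero.1 h1).resolve_right (Finset.prod_ne_zero_iff.2 fun x hx => ?_)
  exact sub_ne_zero.2 fun hc => (Finset.mem_offDiag.1 hx).2.2 (X_injective hc)

theorem symJack_isSymmetric (ι : Fin (n + 1) → ℕ) : (symJack ι).IsSymmetric :=
  symmetrizer_isSymmetric _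

/-- The polynomial `symJack ι` with complex coefficients. -/
noncomputable def symJackC (ι : Fin (n + 1) → ℕ) : MvPolynomial (Fin (n + 1)) ℂ :=
  map (algebraMap ℝ ℂ) (symJack ι)

/-- The eigenvalue of the Laplace–Beltrami operator on `symJack ι`, for `ι` a partition of `k`. -/
noncomputable def laplaceEigenvalue (k : ℕ) (ι : Fin (n + 1) → ℕ) : ℝ :=
  (squareEigenvalue ι - (4 - 2 * n) * k) / 4

theorem deltaAt_symJackC {k : ℕ} {ι : Fin (n + 1) → ℕ} (hι : ι ∈ parts (n + 1) k)
    {α : Fin (n + 1) → ℂ} (hα : Function.Injective α) :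
    deltaAt (symJackC ι) α = (laplaceEigenvalue k ι : ℂ) * eval α (symJackC ι) :=
  deltaAt_map (symJack_isSymmetric ι) (symJack_isHomogeneous hι)
    (sum_heckmanOp_symJack (mem_parts.1 hι).2) hα

theorem deltaAt_sum_smul {d : ℕ} {ι : Type*} (s : Finset ι) (a : ι → ℂ)
    (p : ι → MvPolynomial (Fin d) ℂ) (α : Fin d → ℂ) :
    deltaAt (∑ i ∈ s, a i • p i) α = ∑ i ∈ s, a i * deltaAt (p i) α := by
  simp only [deltaAt, map_sum, Derivation.map_smul, smul_eval, Finset.mul_sum, mul_add,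
    Finset.sum_add_distrib]
  congr 1
  · rw [Finset.sum_comm]
    refine Finset.sum_congr rfl fun _ _ => Finset.sum_congr rfl fun _ _ => by ring
  · conv_rhs => rw [Finset.sum_comm]
    refine Finset.sum_congr rfl fun j _ => ?_
    rw [Finset.sum_comm]
    refine Finset.sum_congr rfl fun _ _ => Finset.sum_congr rfl fun _ _ => by ring

/-- Symmetrized monomials have real coefficients and span the symmetric polynomials over `ℂ`, which
reduces the claim to the real expansion. -/
theorem exists_eq_sum_symJackC {k : ℕ} {f : MvPolynomial (Fin (n + 1)) ℂ} (hs : f.IsSymmetric)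
    (hf : f.IsHomogeneous k) :
    ∃ a : (Fin (n + 1) → ℕ) → ℂ, f = ∑ ι ∈ parts (n + 1) k, a ι • symJackC ι := by
  suffices h : f ∈ Submodule.span ℂ (symJackC '' (parts (n + 1) k : Set (Fin (n + 1) → ℕ))) by
    obtain ⟨a, ha⟩ := (Submodule.mem_span_image_finset_iff_exists_fun ℂ).1 h
    refine ⟨fun ι => if hι : ι ∈ parts (n + 1) k then a ⟨ι, hι⟩ else 0, ?_⟩
    rw [← ha, ← Finset.sum_coe_sort (parts (n + 1) k) fun ι =>
      (if hι : ι ∈ parts (n + 1) k then a ⟨ι, hι⟩ else 0) • symJackC ι]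
    exact Finset.sum_congr rfl fun ι _ => by simp
  have h0 : ((n + 1).factorial : ℂ) ≠ 0 := by exact_mod_cast (n + 1).factorial_ne_zero
  have h1 : ((n + 1).factorial : ℂ) • f = ∑ s ∈ f.support,
      coeff s f • map (algebraMap ℝ ℂ) (symmetrizer (monomial s 1)) := by
    have h2 : ((n + 1).factorial : ℂ) • f = ∑ w : Equiv.Perm (Fin (n + 1)), rename w f := by
      rw [Finset.sum_congr rfl fun w _ => hs w]
      simp [Finset.card_univ, Fintype.card_perm, ← Nat.cast_smul_eq_nsmul ℂ]
    rw [h2]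
    conv_lhs => enter [2, w]; rw [f.as_sum, map_sum]
    rw [Finset.sum_comm]
    refine Finset.sum_congr rfl fun s _ => ?_
    rw [symmetrizer_apply, map_sum, Finset.smul_sum]
    refine Finset.sum_congr rfl fun w _ => ?_
    rw [rename_monomial, rename_monomial, map_monomial, smul_monomial]
    simp
  rw [← inv_smul_smul₀ h0 f, h1]
  refine Submodule.smul_mem _ _ (Submodule.sum_mem _ fun s hs => Submodule.smul_mem _ _ ?_)
  have hdeg : s.degree = k := by
    have := hf (mem_support_iff.1 hs)
    rwa [show (1 : Fin (n + 1) → ℕ) = fun _ => 1 from rfl, ← Finsupp.degree_eq_weight_one] at this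
  obtain ⟨a, ha⟩ := exists_eq_sum_symJack (k := k)
    (symmetrizer_isSymmetric (monomial s (1 : ℝ))) (by
    rw [symmetrizer_apply]
    exact IsHomogeneous.sum _ _ _ fun w _ =>
      IsHomogeneous.rename_isHomogeneous (isHomogeneous_monomial _ hdeg))
  rw [ha, map_sum]
  refine Submodule.sum_mem _ fun ι hι => ?_
  rw [smul_eq_C_mul, map_mul, map_C, ← smul_eq_C_mul]
  exact Submodule.smul_mem _ _ (Submodule.subset_span ⟨ι, hι, rfl⟩)

theorem sum_X_pow_eq_sum_symJackC {k : ℕ} {c : (Fin (n + 1) → ℕ) → ℝ}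
    (h : (∑ i, X i : MvPolynomial (Fin (n + 1)) ℝ) ^ k = ∑ ι ∈ parts (n + 1) k, c ι • symJack ι) :
    (∑ i, X i : MvPolynomial (Fin (n + 1)) ℂ) ^ k =
      ∑ ι ∈ parts (n + 1) k, (c ι : ℂ) • symJackC ι := by
  have h1 := congrArg (map (algebraMap ℝ ℂ)) h
  simp only [map_pow, map_sum, map_X, smul_eq_C_mul, map_mul, map_C] at h1
  simp only [smul_eq_C_mul]
  exact h1

theorem DomLE.antisymm {s t : Fin (n + 1) → ℕ} (h : DomLE s t) (h' : DomLE t s) : s = t :=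
  h.eq_of_partialSums_le h'.partialSums_le

theorem coeff_symJackC_ne_zero {ι : Fin (n + 1) → ℕ} {s : Fin (n + 1) →₀ ℕ} :
    coeff s (symJackC ι) ≠ 0 ↔ coeff s (symJack ι) ≠ 0 := by
  rw [symJackC, coeff_map]
  exact map_ne_zero _

/-- The multiples of the symmetric Jack polynomials with sum `(x_0 + ⋯ + x_n) ^ k` form a family
of zonal polynomials. -/
theorem isZonalFamily_smul_symJackC {k : ℕ} {c : (Fin (n + 1) → ℕ) → ℝ}
    (hc : ∀ ι ∈ parts (n + 1) k, 0 < c ι)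
    (h : (∑ i, X i : MvPolynomial (Fin (n + 1)) ℝ) ^ k = ∑ ι ∈ parts (n + 1) k, c ι • symJack ι) :
    IsZonalFamily (n + 1) k fun ι => (c ι : ℂ) • symJackC ι where
  symmetric ι w := by
    rw [map_smul, symJackC, ← map_rename, symJack_isSymmetric]
  homogeneous ι := by
    rw [smul_eq_C_mul]
    have h1 := (isHomogeneous_C (Fin (n + 1)) (c ι : ℂ)).mul
      ((symJack_isHomogeneous ι.2).map (algebraMap ℝ ℂ))
    rwa [zero_add] at h1
  leading ι := by
    rw [coeff_smul, smul_eq_mul]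
    refine mul_ne_zero (by exact_mod_cast (hc ι ι.2).ne') (coeff_symJackC_ne_zero.2 ?_)
    exact (coeff_symJack_pos (ι : Fin (n + 1) → ℕ)).ne'
  dominated ι s hs := by
    rw [mem_support_iff, coeff_smul] at hs
    exact domLE_of_coeff_symJack_ne_zero (mem_parts.1 ι.2).2
      (coeff_symJackC_ne_zero.1 (right_ne_zero_of_smul hs))
  eigen ι := by
    refine ⟨laplaceEigenvalue k (ι : Fin (n + 1) → ℕ), fun α hα => ?_⟩
    have h1 := deltaAt_sum_smul {(ι : Fin (n + 1) → ℕ)} (fun ν => (c ν : ℂ)) symJackC α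
    rw [Finset.sum_singleton, Finset.sum_singleton, deltaAt_symJackC ι.2 hα] at h1
    rw [h1, smul_eval]
    ring
  sum_eq := by
    rw [sum_X_pow_eq_sum_symJackC h]
    exact Finset.sum_coe_sort (parts (n + 1) k) fun ν => (c ν : ℂ) • symJackC ν

/-- A symmetric eigenfunction dominated by `ι` is a multiple of the symmetric Jack polynomial. -/
theorem eq_smul_symJackC {k : ℕ} {ι : Fin (n + 1) → ℕ} (hι : ι ∈ parts (n + 1) k)
    {f : MvPolynomial (Fin (n + 1)) ℂ} (hs : f.IsSymmetric) (hf : f.IsHomogeneous k)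
    (hlead : coeff (toExp ι) f ≠ 0) (hdom : ∀ s ∈ f.support, DomLE s ι) {c : ℂ}
    (heig : ∀ α : Fin (n + 1) → ℂ, Function.Injective α → deltaAt f α = c * eval α f) :
    ∃ a : ℂ, f = a • symJackC ι := by
  obtain ⟨a, ha⟩ := exists_eq_sum_symJackC hs hf
  -- Above every `μ` that occurs there is a leading monomial that cannot cancel, and it is dominated
  -- by `ι`.
  have hle : ∀ μ ∈ parts (n + 1) k, a μ ≠ 0 → DomLE μ ι := fun μ hμ hne => by
    obtain ⟨ν, -, -, h1, h2⟩ := exists_coeff_ne_zero_of_sum a hμ hne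
    exact h1.trans (hdom _ (mem_support_iff.2 (ha ▸ h2)))
  have hchar : ∀ μ ∈ parts (n + 1) k, a μ ≠ 0 → (laplaceEigenvalue k μ : ℂ) = c := by
    have h1 : ∑ μ ∈ parts (n + 1) k, (a μ * (laplaceEigenvalue k μ - c)) • symJackC μ = 0 := by
      refine eq_zero_of_eval_injective fun α hα => ?_
      have h2 := heig α hα
      rw [ha, deltaAt_sum_smul, map_sum, Finset.mul_sum, ← sub_eq_zero,
        ← Finset.sum_sub_distrib] at h2
      rw [map_sum, ← h2]
      refine Finset.sum_congr rfl fun μ hμ => ?_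
      rw [smul_eval, smul_eval, deltaAt_symJackC hμ hα]
      ring
    intro μ hμ hne
    have h2 := symJack_coeff_unique (K := ℂ) (k := k) (b := fun _ => 0) (h1.trans (by simp)) μ hμ
    exact sub_eq_zero.1 ((mul_eq_zero.1 h2).resolve_left hne)
  have haι : a ι ≠ 0 := by
    rw [ha, coeff_sum] at hlead
    obtain ⟨μ, hμ, h1⟩ := Finset.exists_ne_zero_of_sum_ne_zero hlead
    rw [coeff_smul] at h1
    have h2 : DomLE ι μ := domLE_of_coeff_symJack_ne_zero (mem_parts.1 hμ).2
      (coeff_symJackC_ne_zero.1 (right_ne_zero_of_smul h1))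
    have h3 := left_ne_zero_of_smul h1
    rwa [h2.antisymm (hle μ hμ h3)]
  refine ⟨a ι, ?_⟩
  rw [ha]
  refine Finset.sum_eq_single ι (fun μ hμ hne => ?_) fun h => absurd hι h
  by_contra hc
  have h1 := left_ne_zero_of_smul hc
  -- All terms that occur share one eigenvalue, which strict growth along dominance forbids for `μ`
  -- strictly below `ι`.
  have h2 : laplaceEigenvalue k μ = laplaceEigenvalue k ι := by
    exact_mod_cast (hchar μ hμ h1).trans (hchar ι hι haι).symm
  have h3 := squareEigenvalue_lt hμ hι (hle μ hμ h1) hne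
  unfold laplaceEigenvalue at h2
  linarith

theorem IsZonalFamily.eq_smul_symJackC {k : ℕ} {c : (Fin (n + 1) → ℕ) → ℝ}
    (h : (∑ i, X i : MvPolynomial (Fin (n + 1)) ℝ) ^ k = ∑ ι ∈ parts (n + 1) k, c ι • symJack ι)
    {Z : parts (n + 1) k → MvPolynomial (Fin (n + 1)) ℂ} (hZ : IsZonalFamily (n + 1) k Z) :
    Z = fun ι : parts (n + 1) k => (c ι : ℂ) • symJackC (ι : Fin (n + 1) → ℕ) := by
  choose a ha using fun ι : parts (n + 1) k => show ∃ a : ℂ, Z ι = a • symJackC ι by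
    obtain ⟨e, he⟩ := hZ.eigen ι
    exact _root_.eq_smul_symJackC ι.2 (hZ.symmetric ι) (hZ.homogeneous ι) (hZ.leading ι)
      (hZ.dominated ι) he
  let b : (Fin (n + 1) → ℕ) → ℂ := fun ν => if hν : ν ∈ parts (n + 1) k then a ⟨ν, hν⟩ else 0
  have hb : ∀ ι : parts (n + 1) k, b ι = a ι := fun ι => by simp [b]
  have h1 := hZ.sum_eq
  rw [sum_X_pow_eq_sum_symJackC h, Finset.sum_congr rfl fun ι _ => ha ι] at h1
  simp only [← hb] at h1
  rw [Finset.sum_coe_sort (parts (n + 1) k) fun ν => b ν • symJackC ν] at h1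
  have h2 := symJack_coeff_unique h1
  ext1 ι
  rw [ha, ← hb, h2 ι ι.2]

theorem isZonalFamily_zonal (n k : ℕ) : IsZonalFamily (n + 1) k (zonal (n + 1) k) := by
  obtain ⟨c, hc, h⟩ := exists_sum_X_pow_eq_sum_symJack n k
  exact Classical.epsilon_spec ⟨_, isZonalFamily_smul_symJackC hc h⟩

theorem IsZonalFamily.eq_zonal {k : ℕ} {Z : parts (n + 1) k → MvPolynomial (Fin (n + 1)) ℂ}
    (hZ : IsZonalFamily (n + 1) k Z) : Z = zonal (n + 1) k := by
  obtain ⟨c, -, h⟩ := exists_sum_X_pow_eq_sum_symJack n k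
  rw [hZ.eq_smul_symJackC h, (isZonalFamily_zonal n k).eq_smul_symJackC h]

/-- The zonal polynomials have real, nonnegative coefficients. -/
theorem exists_zonal_eq_map (n k : ℕ) : ∃ C : parts (n + 1) k → MvPolynomial (Fin (n + 1)) ℝ,
    (∀ ι s, 0 ≤ coeff s (C ι)) ∧ (∀ ι, zonal (n + 1) k ι = map (algebraMap ℝ ℂ) (C ι)) ∧
      ∑ ι, C ι = (∑ i, X i) ^ k := by
  obtain ⟨c, hc, h⟩ := exists_sum_X_pow_eq_sum_symJack n k
  refine ⟨fun ι => c ι • symJack ι, fun ι s => ?_, fun ι => ?_, ?_⟩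
  · rw [coeff_smul]
    exact mul_nonneg (hc ι ι.2).le (coeff_symJack_nonneg _ s)
  · rw [(isZonalFamily_zonal n k).eq_smul_symJackC h]
    beta_reduce
    rw [smul_eq_C_mul, smul_eq_C_mul, map_mul, map_C]
    rfl
  · rw [h]
    exact Finset.sum_coe_sort (parts (n + 1) k) fun ν => c ν • symJack ν

theorem norm_eval_map_le {σ : Type*} {p : MvPolynomial σ ℝ} (hp : ∀ s, 0 ≤ coeff s p)
    (α : σ → ℂ) : ‖eval α (map (algebraMap ℝ ℂ) p)‖ ≤ eval (fun i => ‖α i‖) p := by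
  rw [eval_map, eval₂_eq, eval_eq]
  refine (norm_sum_le _ _).trans (Finset.sum_le_sum fun s _ => ?_)
  rw [norm_mul, norm_prod]
  simp only [norm_pow]
  refine mul_le_mul_of_nonneg_right ?_ (Finset.prod_nonneg fun _ _ => by positivity)
  rw [norm_algebraMap', Real.norm_of_nonneg (hp s)]

end zonal

/-! ### The lexicographically smallest partition is the balanced one -/

section lexMin

/-- The partition of `k` into `d` parts that differ by at most `1`. -/
def balancedPart (d k : ℕ) : Fin d → ℕ := fun i => k / d + if (i : ℕ) < k % d then 1 else 0

theorem balancedPart_antitone (d k : ℕ) : Antitone (balancedPart d k) := by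
  intro i j hij
  have : (i : ℕ) ≤ j := hij
  unfold balancedPart
  split_ifs <;> omega

theorem balancedPart_le_add_one {d k : ℕ} (i j : Fin d) :
    balancedPart d k i ≤ balancedPart d k j + 1 := by
  unfold balancedPart
  split_ifs <;> omega

theorem balancedPart_mem_parts (d k : ℕ) [NeZero d] : balancedPart d k ∈ parts d k := by
  refine mem_parts.2 ⟨?_, balancedPart_antitone d k⟩
  have hr : k % d < d := Nat.mod_lt _ (NeZero.pos d)
  have h1 : ∑ i : Fin d, (if (i : ℕ) < k % d then 1 else 0) = k % d := by
    rw [Fin.sum_univ_eq_sum_range (fun i => if i < k % d then 1 else 0) d, ← Finset.sum_filter,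
      Finset.sum_const, smul_eq_mul, mul_one]
    have : (Finset.range d).filter (fun i => i < k % d) = Finset.range (k % d) := by
      ext i; simp; omega
    rw [this, Finset.card_range]
  simp only [balancedPart, Finset.sum_add_distrib, h1]
  simp [Nat.div_add_mod]

theorem lexMinPart_eq (d k : ℕ) [NeZero d] : lexMinPart d k = balancedPart d k := by
  classical
  have hmem : lexMinPart d k ∈ parts d k := by
    obtain ⟨ι, hι, h⟩ := Finset.mem_image.1
      (Finset.min'_mem ((parts d k).image toLex) ((parts_nonempty d k).image toLex))
    rw [lexMinPart, ← h]
    exact hι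
  have hle : toLex (lexMinPart d k) ≤ toLex (balancedPart d k) :=
    Finset.min'_le _ _ (Finset.mem_image_of_mem _ (balancedPart_mem_parts d k))
  rcases hle.eq_or_lt with h | ⟨i, h1, h2⟩
  · exact toLex.injective h
  · exfalso
    obtain ⟨hsum, hanti⟩ := mem_parts.1 hmem
    -- From the first difference `i` on, the smaller partition is at most `balancedPart d k i - 1`,
    -- which no balanced part goes below, so its sum is too small.
    have h3 : ∑ j, lexMinPart d k j < ∑ j, balancedPart d k j := by
      refine Finset.sum_lt_sum (fun j _ => ?_) ⟨i, Finset.mem_univ _, h2⟩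
      rcases lt_or_ge j i with hj | hj
      · exact (h1 j hj).le
      · have h4 := hanti hj
        have h5 := balancedPart_le_add_one (k := k) i j
        have h6 : lexMinPart d k i < balancedPart d k i := h2
        omega
    rw [hsum, (mem_parts.1 (balancedPart_mem_parts d k)).1] at h3
    exact lt_irrefl _ h3

end lexMin

/-! ### Lower bound for the generalized Pochhammer symbols -/

section pochhammer

/-- Passing from `(a)_h` to `(a)_k` either appends factors that are at least `T` or removes factors
that are at most `T`. -/
theorem ascPochhammer_mul_pow_le {a T : ℝ} (ha : 0 < a) (hT : 0 < T) {h k : ℕ}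
    (h₁ : h < k → T ≤ a + h) (h₂ : k < h → a + h - 1 ≤ T) :
    (ascPochhammer ℝ h).eval a * T ^ k ≤ (ascPochhammer ℝ k).eval a * T ^ h := by
  rcases le_total h k with hk | hk
  · obtain ⟨m, rfl⟩ := Nat.exists_eq_add_of_le hk
    rcases Nat.eq_zero_or_pos m with rfl | hm
    · simp
    replace h₁ := h₁ (by omega)
    clear hk h₂ hm
    induction m with
    | zero => simp
    | succ m ih =>
      rw [← add_assoc, pow_succ, ascPochhammer_succ_eval, ← mul_assoc]
      have h3 : T ≤ a + (h + m : ℕ) := by push_cast; have := m.cast_nonneg (α := ℝ); linarith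
      have h4 := ascPochhammer_pos (h + m) a ha
      calc _ ≤ (ascPochhammer ℝ (h + m)).eval a * T ^ h * T := by gcongr
        _ ≤ (ascPochhammer ℝ (h + m)).eval a * T ^ h * (a + (h + m : ℕ)) := by gcongr
        _ = _ := by ring
  · obtain ⟨m, rfl⟩ := Nat.exists_eq_add_of_le hk
    rcases Nat.eq_zero_or_pos m with rfl | hm
    · simp
    replace h₂ := h₂ (by omega)
    clear hk h₁ hm
    induction m with
    | zero => simp
    | succ m ih =>
      rw [← add_assoc, pow_succ, ascPochhammer_succ_eval, ← mul_assoc]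
      have h3 : a + (k + m : ℕ) ≤ T := by push_cast at h₂ ⊢; linarith
      have h5 := ih (by push_cast at h₂ ⊢; linarith)
      have h4 := ascPochhammer_pos (k + m) a ha
      calc _ = (ascPochhammer ℝ (k + m)).eval a * T ^ k * (a + (k + m : ℕ)) := by ring
        _ ≤ (ascPochhammer ℝ (k + m)).eval a * T ^ k * T := by gcongr
        _ ≤ _ := by gcongr

theorem sub_half_pos {d : ℕ} {b : ℝ} (hb : ((d : ℝ) - 1) / 2 < b) (j : Fin d) :
    0 < b - (j : ℕ) / 2 := by
  have : ((j : ℕ) : ℝ) + 1 ≤ d := by exact_mod_cast j.2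
  linarith

theorem genPochhammer_pos {d : ℕ} {b : ℝ} (hb : ((d : ℝ) - 1) / 2 < b) (ι : Fin d → ℕ) :
    0 < genPochhammer b ι :=
  Finset.prod_pos fun j _ => ascPochhammer_pos _ _ (sub_half_pos hb j)

/-- A single threshold `T ≥ 1` separates the factors gained from those lost in passing from the
balanced partition to `ι`. The ratio of the two symbols is then at least `T ^ (k - K) ≥ 1`. -/
theorem genPochhammer_balancedPart_le {d : ℕ} [NeZero d] {b : ℝ} (hb : ((d : ℝ) - 1) / 2 < b)
    {K k : ℕ} (hK : d ≤ K) (hk : K ≤ k) {ι : Fin d → ℕ} (hι : ι ∈ parts d k) :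
    genPochhammer b (balancedPart d K) ≤ genPochhammer b ι := by
  obtain ⟨hsum, hanti⟩ := mem_parts.1 hι
  set h := balancedPart d K with hh
  obtain ⟨hhsum, hhanti⟩ := mem_parts.1 (balancedPart_mem_parts d K)
  have hq : ∀ j, 1 ≤ h j := fun j => by
    have : 1 ≤ K / d := Nat.div_pos hK (NeZero.pos d)
    rw [hh, balancedPart]
    omega
  obtain ⟨T, hT1, hT⟩ : ∃ T : ℝ, 1 ≤ T ∧ ∀ j, (h j < ι j → T ≤ b - (j : ℕ) / 2 + h j) ∧
      (ι j < h j → b - (j : ℕ) / 2 + h j - 1 ≤ T) := by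
    by_cases hex : ∃ j, h j < ι j
    · obtain ⟨j₀, hj₀, hmax⟩ := Finset.exists_max_image
        (Finset.univ.filter fun j => h j < ι j) id
        (by obtain ⟨j, hj⟩ := hex; exact ⟨j, by simpa using hj⟩)
      simp only [Finset.mem_filter, Finset.mem_univ, true_and, id] at hj₀ hmax
      have hmono : ∀ i j : Fin d, i ≤ j →
          b - (j : ℕ) / 2 + h j ≤ b - (i : ℕ) / 2 + h i := fun i j hij => by
        have h1 : ((i : ℕ) : ℝ) ≤ (j : ℕ) := by exact_mod_cast hij
        have h2 : (h j : ℝ) ≤ h i := by exact_mod_cast hhanti hij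
        linarith
      -- The threshold is the first factor gained at the last index `j₀` where `ι` exceeds `h`. It
      -- is at least `1` because `K ≥ d` makes every balanced part positive; as `h` is balanced and
      -- `ι` decreasing, losses occur only after `j₀`.
      refine ⟨b - (j₀ : ℕ) / 2 + h j₀, ?_, fun j => ⟨fun hj => hmono _ _ (hmax j hj), fun hj => ?_⟩⟩
      · have h1 := sub_half_pos hb j₀
        have h2 : (1 : ℝ) ≤ h j₀ := by exact_mod_cast hq j₀
        linarith
      · have hlt : j₀ ≤ j := by
          by_contra hc
          have h1 := hanti (not_le.1 hc).le
          have h2 : h j ≤ h j₀ + 1 := balancedPart_le_add_one j j₀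
          omega
        have := hmono _ _ hlt
        linarith
    · push Not at hex
      -- With no factors gained, any threshold above all the factors lost will do.
      refine ⟨1 + ∑ j : Fin d, |b - (j : ℕ) / 2 + h j|, ?_, fun j => ⟨fun hj => ?_, fun _ => ?_⟩⟩
      · have : 0 ≤ ∑ j : Fin d, |b - (j : ℕ) / 2 + h j| := Finset.sum_nonneg fun _ _ => abs_nonneg _
        linarith
      · exact absurd hj (not_lt.2 (hex j))
      · have h1 := Finset.single_le_sum (f := fun j : Fin d => |b - (j : ℕ) / 2 + h j|)
          (fun _ _ => abs_nonneg _) (Finset.mem_univ j)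
        have h2 := le_abs_self (b - (j : ℕ) / 2 + h j)
        linarith
  have hT0 : 0 < T := by linarith
  have h1 : genPochhammer b h * T ^ k ≤ genPochhammer b ι * T ^ K := by
    rw [← hsum, ← hhsum, ← Finset.prod_pow_eq_pow_sum, ← Finset.prod_pow_eq_pow_sum,
      genPochhammer, genPochhammer, ← Finset.prod_mul_distrib, ← Finset.prod_mul_distrib]
    refine Finset.prod_le_prod (fun j _ => ?_) fun j _ => ?_
    · exact (mul_pos (ascPochhammer_pos _ _ (sub_half_pos hb j)) (pow_pos hT0 _)).le
    · exact ascPochhammer_mul_pow_le (sub_half_pos hb j) hT0 (hT j).1 (hT j).2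
  have h2 : genPochhammer b h * T ^ K ≤ genPochhammer b h * T ^ k :=
    mul_le_mul_of_nonneg_left (pow_le_pow_right₀ hT1 hk) (genPochhammer_pos hb h).le
  exact le_of_mul_le_mul_right (h2.trans h1) (pow_pos hT0 K)

theorem ofReal_genPochhammer {d : ℕ} (b : ℝ) (ι : Fin d → ℕ) :
    genPochhammer (b : ℂ) ι = (genPochhammer b ι : ℝ) := by
  have h : ∀ (m : ℕ) (x : ℝ), (ascPochhammer ℂ m).eval (x : ℂ) =
      ((ascPochhammer ℝ m).eval x : ℝ) := fun m x => by
    induction m with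
    | zero => simp
    | succ m ih => rw [ascPochhammer_succ_eval, ascPochhammer_succ_eval, ih]; push_cast; rfl
  rw [genPochhammer, genPochhammer, Complex.ofReal_prod]
  refine Finset.prod_congr rfl fun j _ => ?_
  rw [← h]
  push_cast
  rfl

end pochhammer

/-! ### Bounding the terms and the tail of the series -/

section series

variable {n : ℕ}

theorem norm_hyp0F1Term_le {b B : ℝ} {k : ℕ} (hB : 0 < B)
    (h : ∀ ι ∈ parts (n + 1) k, B ≤ genPochhammer b ι) (α : Fin (n + 1) → ℂ) :
    ‖hyp0F1Term (b : ℂ) α k‖ ≤ (∑ i, ‖α i‖) ^ k / (k.factorial * B) := by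
  obtain ⟨C, hC, hZ, hsum⟩ := exists_zonal_eq_map n k
  have h1 : (∑ i, ‖α i‖) ^ k = ∑ ι, eval (fun i => ‖α i‖) (C ι) := by
    rw [← map_sum, hsum]
    simp
  have hk : (0 : ℝ) < k.factorial := by exact_mod_cast k.factorial_pos
  rw [h1, Finset.sum_div, hyp0F1Term]
  refine (norm_sum_le _ _).trans (Finset.sum_le_sum fun ι _ => ?_)
  have h2 := h ι ι.2
  have h3 := norm_eval_map_le (hC ι) α
  rw [ofReal_genPochhammer, hZ, norm_mul, norm_div, norm_div, norm_one, Complex.norm_real,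
    Complex.norm_natCast, Real.norm_of_nonneg (hB.le.trans h2), div_mul_div_comm, one_mul,
    mul_comm (k.factorial : ℝ) B]
  exact div_le_div₀ ((norm_nonneg _).trans h3) h3 (by positivity)
    (mul_le_mul_of_nonneg_right h2 hk.le)

theorem pow_add_div_factorial_le {S B : ℝ} (hS : 0 ≤ S) (hB : 0 < B) (k m : ℕ) :
    S ^ (k + m) / ((k + m).factorial * B) ≤
      S ^ m / (m.factorial * B) * (S ^ k / k.factorial) := by
  have h1 : ((k.factorial * m.factorial : ℕ) : ℝ) ≤ ((k + m).factorial : ℕ) := by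
    exact_mod_cast Nat.le_of_dvd (Nat.factorial_pos _)
      (Nat.factorial_mul_factorial_dvd_factorial_add k m)
  push_cast at h1
  have hk : (0 : ℝ) < k.factorial := by exact_mod_cast k.factorial_pos
  have hm : (0 : ℝ) < m.factorial := by exact_mod_cast m.factorial_pos
  rw [div_mul_div_comm, ← pow_add, add_comm m k]
  refine div_le_div_of_nonneg_left (by positivity) (by positivity) ?_
  nlinarith

theorem hasSum_pow_div_factorial (S : ℝ) :
    HasSum (fun k : ℕ => S ^ k / k.factorial) (Real.exp S) := by
  rw [Real.exp_eq_exp_ℝ]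
  exact NormedSpace.expSeries_div_hasSum_exp S

end series

theorem mainTheorem4 (d : ℕ) [NeZero d] (b : ℝ) (hb : ((d : ℝ) - 1) / 2 < b)
    (m : ℕ) (hm : d - 1 ≤ m) (α : Fin d → ℂ) :
    (∀ k : ℕ, IsZonalFamily d k (zonal d k) ∧
      ∀ Z : parts d k → MvPolynomial (Fin d) ℂ, IsZonalFamily d k Z → Z = zonal d k) ∧
    Summable (hyp0F1Term (b : ℂ) α) ∧
    0 < genPochhammer b (lexMinPart d (m + 1)) ∧
    ‖hyp0F1 (b : ℂ) α - hyp0F1Trunc m (b : ℂ) α‖ ≤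
      (∑ i, ‖α i‖) ^ (m + 1) /
          (((m + 1).factorial : ℝ) * genPochhammer b (lexMinPart d (m + 1))) *
        Real.exp (∑ i, ‖α i‖) := by
  obtain ⟨n, rfl⟩ : ∃ n, d = n + 1 := Nat.exists_eq_succ_of_ne_zero (NeZero.ne d)
  have hB := genPochhammer_pos hb (lexMinPart (n + 1) (m + 1))
  set B := genPochhammer b (lexMinPart (n + 1) (m + 1)) with hBdef
  set S := ∑ i, ‖α i‖
  have hS : 0 ≤ S := Finset.sum_nonneg fun _ _ => norm_nonneg _
  have hterm : ∀ k, ‖hyp0F1Term (b : ℂ) α (k + (m + 1))‖ ≤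
      S ^ (m + 1) / ((m + 1).factorial * B) * (S ^ k / k.factorial) := fun k => by
    refine (norm_hyp0F1Term_le hB (fun ι hι => ?_) α).trans (pow_add_div_factorial_le hS hB k _)
    rw [hBdef, lexMinPart_eq]
    -- The assumption `d - 1 ≤ m` enters here, as `d ≤ m + 1`.
    exact genPochhammer_balancedPart_le hb (by omega) (by omega) hι
  have hexp := (hasSum_pow_div_factorial S).mul_left (S ^ (m + 1) / ((m + 1).factorial * B))
  have hsum : Summable (hyp0F1Term (b : ℂ) α) :=
    (summable_nat_add_iff (m + 1)).1 (Summable.of_norm_bounded hexp.summable hterm)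
  refine ⟨fun k => ⟨isZonalFamily_zonal n k, fun Z hZ => hZ.eq_zonal⟩, hsum, hB, ?_⟩
  have h1 := hsum.sum_add_tsum_nat_add (m + 1)
  rw [hyp0F1, hyp0F1Trunc, ← h1, add_sub_cancel_left]
  exact tsum_of_norm_bounded hexp hterm
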